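/- Let $D\ge 1$ and let $\mathcal X\subseteq\mathbb R^D$ be compact. Let $P_{\mathcal X}$ be a probability distribution on $\mathcal X$ with density $p_X$ with respect to Lebesgue measure, let $\eta:\mathcal X\to[0,1]$ be measurable, and let $\mathcal F$ be the law of $(X,Y)$ with $X\sim P_{\mathcal X}$, $Y\in\{0,1\}$ and $\mathbb P(Y=1\mid X=x)=\eta(x)$. Write $|\cdot|$ for the Euclidean norm and $B(x,r)$ for the closed Euclidean ball. Assume: 1. there are $\omega,r_0>0$ with $\mathrm{Vol}(\mathcal X\cap B(x,r))\ge\omega\,\mathrm{Vol}(B(x,r))$ for all $x\in\mathcal X$, $0<r<r_0$; 2. $\inf_{x\in\mathcal X}p_X(x)>0$; 3. for some $0<\alpha\le1$ and $C_\alpha>0$, $|\eta(x)-\eta(x')|\le C_\alpha|x-x'|^\alpha$ for all $x,x'\in\mathcal X$. For a finite $C\subset\mathcal X$ put $S_2(C)=\min_{x\ne x'\in C}|x-x'|$ ($=+\infty$ if $C$ has fewer than two points). For $\Delta\ge0$ put $\mathcal X^\Delta=\{x\in\mathcal X:|\tfrac12-\eta(x)|\ge\Delta\}$, and let $\eta^*(x)=1[\eta(x)\ge\tfrac12]$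 be the Bayes-optimal label. For a finite labelled sample, let $r_k(x)$ be the infimum of all $r$ such that $B(x,r)$ contains at least $k$ sample points, let $N_k(x)$ be the set of sample points in $B(x,r_k(x))$, let $\eta_k(y;x)$ be the fraction of the points in $N_k(x)$ whose label is $y$, and let the $k$-NN prediction at $x$ be $\operatorname{argmax}_y\eta_k(y;x)$ (with ties broken arbitrarily). Then there are constants $K_l,K_u,K>0$, depending only on $\mathcal F$ (and $\alpha$), such that for every $\delta>0$ and $n\ge1$ the following holds with probability at least $1-\delta$ over $n$ independent (uncorrupted) examples $X_{[n]}$ drawn from $\mathcal F$. For every finite set $C\subset\mathcal X$ of points with arbitrary (corrupted) labels and every $k\in\mathbb N$ with $$K_l\,\log^2(1/\delta)\,n^{\frac{\alpha}{\alpha+D}}\;\le\;k\;\le\;K_u\,S_2(C)^D\,n,$$ and with $$\Delta=K\left(\sqrt{\frac{\log n+\log(1/\delta)}{k}}+\Big(\frac kn\Big)^{\alpha/D}\right),$$ we have, simultaneously for all $x\in\mathcal X^\Delta$: the $k$-NN prediction at $x$ computed from $X_{[n]}\cup C$ agrees with a label $y\in\{0,1\}$ if and only if $y=\eta^*(x)$.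 Moreover, for fixed $\delta>0$, if $k=k_n\asymp n^{2\alpha/(2\alpha+D)}$ then $k_n$ satisfies the above lower bound for all large $n$, and $\Delta=\widetilde O(n^{-\alpha/(2\alpha+D)})$, i.e. $\Delta=O(n^{-\alpha/(2\alpha+D)}(\log n)^m)$ for some $m$. -/

import Mathlib

open MeasureTheory Filter Asymptotics
open scoped ENNReal Topology

namespace DeepKNN

/-- The ambient feature space `ℝ^D` with the Euclidean norm. -/
abbrev Point (D : ℕ) : Type := EuclideanSpace ℝ (Fin D)

/-- Support regularity: `Vol(𝒳 ∩ B(x, r)) ≥ ω Vol(B(x, r))` for all `x ∈ 𝒳` and `0 < r < r₀`. -/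
def SupportRegular {D : ℕ} (𝒳 : Set (Point D)) : Prop :=
  ∃ ω : ℝ, 0 < ω ∧ ∃ r₀ : ℝ, 0 < r₀ ∧ ∀ x ∈ 𝒳, ∀ r : ℝ, 0 < r → r < r₀ →
    ENNReal.ofReal ω * volume (Metric.closedBall x r) ≤ volume (𝒳 ∩ Metric.closedBall x r)

/-- `η` is Hölder continuous on `𝒳` with exponent `α`. -/
def HolderContinuousOn {D : ℕ} (α : ℝ) (η : Point D → ℝ) (𝒳 : Set (Point D)) : Prop :=
  ∃ Cα : ℝ, 0 < Cα ∧ ∀ x ∈ 𝒳, ∀ x' ∈ 𝒳, |η x - η x'| ≤ Cα * ‖x - x'‖ ^ α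

/-- The law `ℱ` of a labelled example `(X, Y)`: `X` has law `P` and `ℙ(Y = 1 | X = x) = η x`.
The label `1` is `true` and the label `0` is `false`. -/
noncomputable def jointLaw {D : ℕ} (P : Measure (Point D)) (η : Point D → ℝ) :
    Measure (Point D × Bool) :=
  (P.withDensity fun x => ENNReal.ofReal (η x)).map (fun x => (x, true)) +
    (P.withDensity fun x => ENNReal.ofReal (1 - η x)).map (fun x => (x, false))

/-- The Bayes-optimal label `1[η x ≥ 1/2]`. -/
noncomputable def bayesLabel {D : ℕ} (η : Point D → ℝ) (x : Point D) : Bool :=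
  open Classical in decide (1 / 2 ≤ η x)

/-- The `Δ`-interior region: the points of `𝒳` where the margin is at least `Δ`. -/
def interiorRegion {D : ℕ} (𝒳 : Set (Point D)) (η : Point D → ℝ) (Δ : ℝ) : Set (Point D) :=
  {x ∈ 𝒳 | Δ ≤ |1 / 2 - η x|}

/-- The minimum pairwise distance `S₂(C)`; it is `∞` when `C` has fewer than two points. -/
noncomputable def minPairwiseDist {D : ℕ} (C : Set (Point D)) : ℝ≥0∞ := C.einfsep

section Classifier

variable {D : ℕ} {ι : Type*} [Fintype ι]

open Classical in
/-- The examples (as indices) whose feature vector lies in the closed ball `B(x, r)`. -/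
noncomputable def inBall (S : ι → Point D × Bool) (x : Point D) (r : ℝ) : Finset ι :=
  Finset.univ.filter fun i => (S i).1 ∈ Metric.closedBall x r

/-- The `k`-NN radius `r_k(x)`: the infimum of the radii `r` such that `B(x, r)` contains at
least `k` examples. -/
noncomputable def kNNRadius (S : ι → Point D × Bool) (k : ℕ) (x : Point D) : ℝ :=
  sInf {r : ℝ | k ≤ (inBall S x r).card}

/-- The `k`-NN set `N_k(x)`, as a set of indices of examples. -/
noncomputable def kNNSet (S : ι → Point D × Bool) (k : ℕ) (x : Point D) : Finset ι :=
  inBall S x (kNNRadius S k x)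

/-- The discriminant `η_k(y; x)`: the fraction of the examples in `N_k(x)` with label `y`. -/
noncomputable def kNNScore (S : ι → Point D × Bool) (k : ℕ) (x : Point D) (y : Bool) : ℝ :=
  (((kNNSet S k x).filter fun i => (S i).2 = y).card : ℝ) / ((kNNSet S k x).card : ℝ)

/-- `y` is a `k`-NN prediction at `x`, i.e. `y` is an element of `argmax_y η_k(y; x)`. -/
def IsKNNPrediction (S : ι → Point D × Bool) (k : ℕ) (x : Point D) (y : Bool) : Prop :=
  ∀ y' : Bool, kNNScore S k x y' ≤ kNNScore S k x y

end Classifier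

/-- The full sample: the `n` uncorrupted examples `S` together with one example for each point of
the finite set `C`, labelled by `c`. -/
def pooledSample {D n : ℕ} (S : Fin n → Point D × Bool) (C : Finset (Point D)) (c : C → Bool) :
    Fin n ⊕ C → Point D × Bool :=
  Sum.elim S fun z => ((z : Point D), c z)

/-- `K (√((log n + log (1/δ)) / k) + (k / n)^(α / D))`. -/
noncomputable def marginRate (D : ℕ) (α K δ : ℝ) (n k : ℕ) : ℝ :=
  K * (√((Real.log n + Real.log (1 / δ)) / k) + ((k : ℝ) / n) ^ (α / D))

end DeepKNN

open DeepKNN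

/-!
Every point with a large margin is classified correctly because three uniform facts hold together
with probability at least `1 - δ`. Write `ℓ = log n + log (1/δ)`.

* *Balls contain enough examples* (`measure_exists_card_lt_le`). Support regularity and the lower
  bound on the density give `P (B(x, r)) ≥ c r ^ D`. With `ρ = (4 k / (c n)) ^ (1/D)` a maximal
  packing of `𝒳` by balls of radius `ρ` has at most `n` members, and a Chernoff bound shows that
  each of them contains `k` examples. As `B(x, 3 ρ)` contains one of these balls, the `k`-NN radius
  is at most `3 ρ` for all `x ∈ 𝒳` and all relevant `k ≥ 4 ℓ` at once.
* *Labels concentrate in every ball* (`measure_exists_ballTrace_deviation_le`). Conditionally on the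
  features the labels are independent, and Hoeffding's inequality controls
  `∑ (Y i - η (X i))` over a fixed index set. Balls cut out at most `(n + 1) ^ (D + 2)` index sets,
  by the Sauer-Shelah lemma, as they shatter no set of `D + 3` points. So the sum over any ball with
  `m` examples deviates by `O(√(m ℓ))` at most.
* *Few corrupted points* (`eq_of_mem_closedBall_of_le_minPairwiseDist`). The upper bound on `k`
  makes the points of `C` farther apart than the diameter `6 ρ`, so a `k`-NN ball contains at
  most one.

A point `x` with margin `Δ` then has a `k`-NN ball in which, by the Hölder condition, every
`η (X i)` is on the same side of `1/2` as `η x`, with margin `Δ / 2`. The majority for the Bayes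
label is `m Δ / 2` in mean, which exceeds the deviation and the single corrupted vote
(`kNNScore_not_lt_of_margin`).

For `k ≥ 1`, a nonempty interior region forces `k ≥ 4 K² ℓ` and `k < n` through `Δ` alone, since
margins do not exceed `1/2`. The explicit lower bound on `k` enters only to ensure `k ≥ 1`.
-/

namespace DeepKNN

/-! ### Traces of balls on a finite sample -/

/-- `T` is the set of indices of the points of `X` that lie in some closed ball. Negative radii are
allowed; they only contribute the empty trace. -/
def IsBallTrace {D : ℕ} {ι : Type*} (X : ι → Point D) (T : Finset ι) : Prop :=
  ∃ (c : Point D) (r : ℝ), ∀ i, i ∈ T ↔ X i ∈ Metric.closedBall c r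

/-- Closed balls in `ℝ^D` shatter no set of `D + 3` points. Among that many points there is a linear
dependency `g` between the vectors `(x, |x|², 1)`, and it annihilates every function
`|x - c|² - r²`; this is impossible for a ball that picks out exactly the points with `0 < g`. -/
lemma card_le_of_forall_subset_ballTrace {D : ℕ} {ι : Type*} [DecidableEq ι] (X : ι → Point D)
    (s : Finset ι) (hs : ∀ u ⊆ s, ∃ T, IsBallTrace X T ∧ s ∩ T = u) : s.card ≤ D + 2 := by
  by_contra! hcard
  let v : s → Point D × ℝ × ℝ := fun i => (X i, ‖X i‖ ^ 2, 1)
  have hdep : ¬ LinearIndependent ℝ v := by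
    intro h
    have h1 := h.fintype_card_le_finrank
    simp at h1
    omega
  obtain ⟨g, hg, i₀, hi₀⟩ := Fintype.not_linearIndependent_iff.1 hdep
  have h1 : ∑ i, g i • X (i : ι) = 0 := by
    have := congrArg Prod.fst hg
    simpa [v, Prod.fst_sum] using this
  have h2 : ∑ i, g i * ‖X (i : ι)‖ ^ 2 = 0 := by
    have := congrArg (fun z => z.2.1) hg
    simpa [v, Prod.fst_sum, Prod.snd_sum] using this
  have h3 : ∑ i, g i = 0 := by
    have := congrArg (fun z => z.2.2) hg
    simpa [v, Prod.snd_sum] using this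
  obtain ⟨p, hp⟩ : ∃ i, 0 < g i := by
    by_contra! hneg
    exact hi₀ ((Finset.sum_eq_zero_iff_of_nonpos fun i _ => hneg i).1 h3 i₀ (Finset.mem_univ _))
  obtain ⟨q, hq⟩ : ∃ i, g i < 0 := by
    by_contra! hpos
    exact hi₀ ((Finset.sum_eq_zero_iff_of_nonneg fun i _ => hpos i).1 h3 i₀ (Finset.mem_univ _))
  classical
  obtain ⟨T, ⟨c, r, hT⟩, hTs⟩ := hs ((Finset.univ.filter fun i : s => 0 < g i).map
    (Function.Embedding.subtype _)) (by
      intro i hi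
      obtain ⟨j, -, rfl⟩ := Finset.mem_map.1 hi
      exact j.2)
  have hmem : ∀ i : s, 0 < g i ↔ dist (X i) c ≤ r := by
    intro i
    rw [← Metric.mem_closedBall, ← hT i]
    have h4 : (i : ι) ∈ s ∩ T ↔ 0 < g i := by
      rw [hTs]; simp
    rw [← h4]; simp
  have hr : 0 ≤ r := dist_nonneg.trans ((hmem p).1 hp)
  -- the affine dependency annihilates every function `|x - c|² - r²`
  have hzero : ∑ i : s, g i * (dist (X i) c ^ 2 - r ^ 2) = 0 := by
    have h5 : ∀ i : s, g i * (dist (X i) c ^ 2 - r ^ 2) =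
        g i * ‖X i‖ ^ 2 - 2 * inner ℝ (g i • X i) c + g i * (‖c‖ ^ 2 - r ^ 2) := by
      intro i
      rw [dist_eq_norm, norm_sub_sq_real, inner_smul_left]
      simp
      ring
    simp_rw [h5]
    rw [Finset.sum_add_distrib, Finset.sum_sub_distrib, h2, ← Finset.mul_sum, ← sum_inner, h1,
      ← Finset.sum_mul, h3]
    simp
  have hneg : ∑ i : s, g i * (dist (X i) c ^ 2 - r ^ 2) < 0 := by
    refine Finset.sum_neg' (fun i _ => ?_) ⟨q, Finset.mem_univ _, ?_⟩
    · rcases lt_or_ge 0 (g i) with h | h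
      · have := (hmem i).1 h
        have : dist (X i) c ^ 2 ≤ r ^ 2 := by gcongr
        nlinarith
      · have h6 : r < dist (X i) c := by
          by_contra! h6
          exact absurd ((hmem i).2 h6) (not_lt.2 h)
        have : r ^ 2 < dist (X i) c ^ 2 := by gcongr
        nlinarith
    · have h6 : r < dist (X q) c := by
        by_contra! h6
        exact absurd ((hmem q).2 h6) (not_lt.2 hq.le)
      have : r ^ 2 < dist (X q) c ^ 2 := by gcongr
      nlinarith
  exact absurd hzero hneg.ne

lemma sum_choose_le_add_one_pow (n d : ℕ) :
    ∑ k ∈ Finset.Iic d, n.choose k ≤ (n + 1) ^ d := by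
  have h : (n + 1) ^ d = ∑ k ∈ Finset.range (d + 1), n ^ k * d.choose k := by
    rw [add_pow]; simp
  rw [h, ← Nat.range_succ_eq_Iic]
  refine Finset.sum_le_sum fun k hk => ?_
  have hk' : k ≤ d := by simpa [Nat.lt_succ_iff] using hk
  calc n.choose k ≤ n ^ k := Nat.choose_le_pow n k
    _ ≤ n ^ k * d.choose k := Nat.le_mul_of_pos_right _ (Nat.choose_pos hk')

open Classical in
/-- Polynomial growth of the number of traces of balls, from the Sauer-Shelah lemma. -/
lemma card_ballTrace_le {D : ℕ} {ι : Type*} [Fintype ι] (X : ι → Point D) :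
    (Finset.univ.filter fun T : Finset ι => IsBallTrace X T).card
      ≤ (Fintype.card ι + 1) ^ (D + 2) := by
  set 𝒜 := Finset.univ.filter fun T : Finset ι => IsBallTrace X T with h𝒜
  have hvc : 𝒜.vcDim ≤ D + 2 := by
    refine Finset.sup_le fun s hs => ?_
    refine card_le_of_forall_subset_ballTrace X s fun u hu => ?_
    obtain ⟨T, hT, hTu⟩ := (Finset.mem_shatterer.1 hs) hu
    exact ⟨T, (Finset.mem_filter.1 hT).2, hTu⟩
  calc 𝒜.card ≤ 𝒜.shatterer.card := Finset.card_le_card_shatterer 𝒜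
    _ ≤ ∑ k ∈ Finset.Iic 𝒜.vcDim, (Fintype.card ι).choose k := Finset.card_shatterer_le_sum_vcDim
    _ ≤ (Fintype.card ι + 1) ^ 𝒜.vcDim := sum_choose_le_add_one_pow _ _
    _ ≤ _ := Nat.pow_le_pow_right (by omega) hvc

/-- Enlarging the radius slightly makes all the inequalities that define a trace strict, so
realizing a given trace is an open condition. This supplies measurability. -/
lemma isOpen_setOf_isBallTrace {D : ℕ} {ι : Type*} [Finite ι] (T : Finset ι) :
    IsOpen {X : ι → Point D | IsBallTrace X T} := by
  have h : {X : ι → Point D | IsBallTrace X T} = ⋃ (c : Point D) (r : ℝ),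
      {X : ι → Point D | (∀ i ∈ T, dist (X i) c < r) ∧ ∀ i ∉ T, r < dist (X i) c} := by
    ext X
    simp only [Set.mem_ofPred_eq, Set.mem_iUnion]
    constructor
    · rintro ⟨c, r, h⟩
      have h1 : ∀ᶠ r' in 𝓝[>] r, ∀ i, i ∉ T → r' < dist (X i) c := by
        refine eventually_all.2 fun i => ?_
        by_cases hi : i ∈ T
        · simp [hi]
        · have : r < dist (X i) c := by
            by_contra! h2
            exact hi ((h i).2 h2)
          filter_upwards [nhdsWithin_le_nhds (Iio_mem_nhds this)] with r' hr' _ using hr'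
      obtain ⟨r', hr', hrr'⟩ := (h1.and self_mem_nhdsWithin).exists
      exact ⟨c, r', fun i hi => lt_of_le_of_lt ((h i).1 hi) hrr', hr'⟩
    · rintro ⟨c, r, h1, h2⟩
      refine ⟨c, r, fun i => ⟨fun hi => (h1 i hi).le, fun hi => ?_⟩⟩
      by_contra hiT
      exact absurd (h2 i hiT) (not_lt.2 hi)
  rw [h]
  refine isOpen_iUnion fun c => isOpen_iUnion fun r => ?_
  simp only [Set.ofPred_and, Set.ofPred_forall]
  refine IsOpen.inter ?_ ?_
  · exact isOpen_iInter_of_finite fun i => isOpen_iInter_of_finite fun _ =>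
      isOpen_lt (by fun_prop) continuous_const
  · exact isOpen_iInter_of_finite fun i => isOpen_iInter_of_finite fun _ =>
      isOpen_lt continuous_const (by fun_prop)

/-! ### Uniform label deviations over balls -/

/-- The uniform distribution on `[0, 1]`, as a measure on `ℝ`. -/
noncomputable def uniform01 : Measure ℝ := volume.restrict (Set.Icc 0 1)

instance : IsProbabilityMeasure uniform01 := ⟨by simp [uniform01]⟩

lemma uniform01_Iic {a : ℝ} (ha : a ∈ Set.Icc (0 : ℝ) 1) :
    uniform01 (Set.Iic a) = ENNReal.ofReal a := by
  have : Set.Iic a ∩ Set.Icc (0 : ℝ) 1 = Set.Icc 0 a := by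
    ext u
    simp only [Set.mem_inter_iff, Set.mem_Iic, Set.mem_Icc]
    constructor
    · rintro ⟨h1, h2, h3⟩; exact ⟨h2, h1⟩
    · rintro ⟨h1, h2⟩; exact ⟨h2, h1, h2.trans ha.2⟩
  rw [uniform01, Measure.restrict_apply measurableSet_Iic, this, Real.volume_Icc, sub_zero]

lemma uniform01_Ioi {a : ℝ} (ha : a ∈ Set.Icc (0 : ℝ) 1) :
    uniform01 (Set.Ioi a) = ENNReal.ofReal (1 - a) := by
  rw [← Set.compl_Iic, prob_compl_eq_one_sub measurableSet_Iic, uniform01_Iic ha,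
    ENNReal.ofReal_sub _ ha.1, ENNReal.ofReal_one]

open Classical in
/-- The label `1[u ≤ a]`, which is `1` with probability `a` when `u` is uniform on `[0, 1]`. -/
noncomputable def uniformLabel (a u : ℝ) : Bool := decide (u ≤ a)

lemma measurable_uniformLabel {D : ℕ} {η : Point D → ℝ} (hη : Measurable η) :
    Measurable fun z : Point D × ℝ => (z.1, uniformLabel (η z.1) z.2) := by
  refine measurable_fst.prodMk (measurable_to_bool ?_)
  have : (fun z : Point D × ℝ => uniformLabel (η z.1) z.2) ⁻¹' {true} = {z | z.2 ≤ η z.1} := by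
    ext z; simp [uniformLabel]
  rw [this]
  exact measurableSet_le measurable_snd (hη.comp measurable_fst)

/-- A labelled example is generated by an independent pair of a feature vector and a uniform
variable. This makes the labels conditionally independent given the features. -/
lemma jointLaw_eq_map {D : ℕ} {P : Measure (Point D)} [SFinite P] {η : Point D → ℝ}
    (hη : Measurable η) (hη01 : ∀ x, η x ∈ Set.Icc (0 : ℝ) 1) :
    jointLaw P η = (P.prod uniform01).map fun z => (z.1, uniformLabel (η z.1) z.2) := by
  ext s hs
  have hT : MeasurableSet ((fun x : Point D => (x, true)) ⁻¹' s) := measurable_prodMk_right hs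
  have hF : MeasurableSet ((fun x : Point D => (x, false)) ⁻¹' s) := measurable_prodMk_right hs
  rw [Measure.map_apply (measurable_uniformLabel hη) hs,
    Measure.prod_apply (measurable_uniformLabel hη hs), jointLaw, Measure.add_apply,
    Measure.map_apply measurable_prodMk_right hs, Measure.map_apply measurable_prodMk_right hs,
    withDensity_apply _ hT, withDensity_apply _ hF, ← lintegral_indicator hT,
    ← lintegral_indicator hF, ← lintegral_add_left (by
      exact (hη.ennreal_ofReal).indicator hT)]
  refine lintegral_congr fun x => ?_
  have hset : Prod.mk x ⁻¹' ((fun z : Point D × ℝ => (z.1, uniformLabel (η z.1) z.2)) ⁻¹' s) =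
      (Set.Iic (η x) ∩ {_u | (x, true) ∈ s}) ∪ (Set.Ioi (η x) ∩ {_u | (x, false) ∈ s}) := by
    ext u
    rcases le_or_gt u (η x) with h | h
    · simp [uniformLabel, h]
    · simp [uniformLabel, h, not_le.2 h]
  rw [hset, measure_union]
  · congr 1
    · by_cases h : (x, true) ∈ s <;> simp [h, Set.indicator, uniform01_Iic (hη01 x)]
    · by_cases h : (x, false) ∈ s <;> simp [h, Set.indicator, uniform01_Ioi (hη01 x)]
  · exact Set.disjoint_left.2 fun u hu hu' => not_le.2 (Set.mem_Ioi.1 hu'.1) hu.1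
  · exact measurableSet_Ioi.inter (by simp)

/-- The law of the sample, disintegrated over the feature vectors. -/
lemma pi_jointLaw_apply {D : ℕ} {ι : Type*} [Fintype ι] {P : Measure (Point D)}
    [IsProbabilityMeasure P] {η : Point D → ℝ}
    (hη : Measurable η) (hη01 : ∀ x, η x ∈ Set.Icc (0 : ℝ) 1) {s : Set (ι → Point D × Bool)}
    (hs : MeasurableSet s) :
    Measure.pi (fun _ : ι => jointLaw P η) s =
      ∫⁻ X : ι → Point D, Measure.pi (fun _ : ι => uniform01)
        {u | (fun i => (X i, uniformLabel (η (X i)) (u i))) ∈ s} ∂Measure.pi (fun _ : ι => P) := by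
  have hf := measurable_uniformLabel hη
  have hsf : SigmaFinite ((P.prod uniform01).map
      fun z : Point D × ℝ => (z.1, uniformLabel (η z.1) z.2)) :=
    @IsFiniteMeasure.toSigmaFinite _ _ _ (Measure.isFiniteMeasure_map _ _)
  have hF : Measurable fun (z : ι → Point D × ℝ) (i : ι) =>
      ((z i).1, uniformLabel (η (z i).1) (z i).2) :=
    measurable_pi_lambda _ fun i => hf.comp (measurable_pi_apply i)
  have hG : Measurable fun (w : (ι → Point D) × (ι → ℝ)) (i : ι) =>
      (w.1 i, uniformLabel (η (w.1 i)) (w.2 i)) :=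
    measurable_pi_lambda _ fun i => hf.comp (g := fun z : Point D × ℝ =>
      (z.1, uniformLabel (η z.1) z.2)) (f := fun w : (ι → Point D) × (ι → ℝ) => (w.1 i, w.2 i))
      (((measurable_pi_apply i).comp measurable_fst).prodMk
        ((measurable_pi_apply i).comp measurable_snd))
  have hmp := measurePreserving_arrowProdEquivProdArrow (Point D) ℝ ι (fun _ => P)
    (fun _ => uniform01)
  rw [jointLaw_eq_map hη hη01, ← Measure.pi_map_pi (hμ := fun _ => hsf) fun _ => hf.aemeasurable,
    Measure.map_apply hF hs]
  have h := (hmp.measure_preimage (hG hs).nullMeasurableSet).trans (Measure.prod_apply (hG hs))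
  exact h

/-- The label as a real number. -/
def labelValue (y : Bool) : ℝ := if y then 1 else 0

lemma measurable_uniformLabel_right (a : ℝ) : Measurable (uniformLabel a) := by
  refine measurable_to_bool ?_
  have : uniformLabel a ⁻¹' {true} = Set.Iic a := by ext; simp [uniformLabel]
  rw [this]; exact measurableSet_Iic

lemma integral_labelValue_uniformLabel {a : ℝ} (ha : a ∈ Set.Icc (0 : ℝ) 1) :
    ∫ u, labelValue (uniformLabel a u) ∂uniform01 = a := by
  have : (fun u => labelValue (uniformLabel a u)) = (Set.Iic a).indicator 1 := by
    ext u; simp [labelValue, uniformLabel, Set.indicator]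
  rw [this, integral_indicator_one measurableSet_Iic, measureReal_def, uniform01_Iic ha,
    ENNReal.toReal_ofReal ha.1]

open ProbabilityTheory in
/-- Hoeffding's inequality for the labels with indices in `T`, for fixed features. The strict
inequality makes the statement true for empty `T` as well. -/
lemma uniform_deviation_le {ι : Type*} [Fintype ι] {a : ι → ℝ}
    (ha : ∀ i, a i ∈ Set.Icc (0 : ℝ) 1) (T : Finset ι) {t : ℝ} (ht : 0 ≤ t) :
    Measure.pi (fun _ : ι => uniform01)
      {u | √(T.card * t / 2) < |∑ i ∈ T, (labelValue (uniformLabel (a i) (u i)) - a i)|}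
      ≤ ENNReal.ofReal (2 * Real.exp (-t)) := by
  rcases T.eq_empty_or_nonempty with rfl | hT
  · simp
  set μ := Measure.pi (fun _ : ι => uniform01)
  have hmeas : ∀ i, Measurable fun u : ℝ => labelValue (uniformLabel (a i) u) - a i := fun i =>
    ((measurable_of_finite labelValue).comp (measurable_uniformLabel_right _)).sub_const _
  have hsub : ∀ i, HasSubgaussianMGF
      (fun u : ι → ℝ => labelValue (uniformLabel (a i) (u i)) - a i) ((‖(1 : ℝ) - 0‖₊ / 2) ^ 2)
      μ := by
    intro i
    have h := hasSubgaussianMGF_of_mem_Icc (μ := uniform01) (a := 0) (b := 1)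
      (X := fun u => labelValue (uniformLabel (a i) u))
      ((measurable_of_finite labelValue).comp (measurable_uniformLabel_right _)).aemeasurable
      (Eventually.of_forall fun u => by
        unfold labelValue; split_ifs <;> simp)
    rw [integral_labelValue_uniformLabel (ha i)] at h
    have hmp := measurePreserving_eval (fun _ : ι => uniform01) i
    rw [← hmp.map_eq] at h
    exact h.of_map hmp.measurable.aemeasurable
  have hind : iIndepFun (fun i (u : ι → ℝ) => labelValue (uniformLabel (a i) (u i)) - a i) μ :=
    iIndepFun_pi (X := fun i u => labelValue (uniformLabel (a i) u) - a i)
      fun i => (hmeas i).aemeasurable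
  have hcard : (0 : ℝ) < T.card := by exact_mod_cast hT.card_pos
  have hexp : ∀ s : ℝ, s = T.card * ((1 : ℝ) / 2) ^ 2 →
      -√(T.card * t / 2) ^ 2 / (2 * s) = -t := by
    rintro s rfl
    rw [Real.sq_sqrt (by positivity)]
    field_simp
  have hup := HasSubgaussianMGF.measure_sum_ge_le_of_iIndepFun hind (s := T)
    (fun i _ => hsub i) (Real.sqrt_nonneg (T.card * t / 2))
  have hdown := HasSubgaussianMGF.measure_sum_ge_le_of_iIndepFun
    (hind.comp (fun _ => Neg.neg) (fun _ => measurable_neg)) (s := T)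
    (fun i _ => (hsub i).neg) (Real.sqrt_nonneg (T.card * t / 2))
  rw [hexp _ (by simp)] at hup hdown
  have hup' := ENNReal.ofReal_le_ofReal hup
  have hdown' := ENNReal.ofReal_le_ofReal hdown
  rw [ofReal_measureReal] at hup' hdown'
  rw [two_mul, ENNReal.ofReal_add (Real.exp_pos _).le (Real.exp_pos _).le]
  refine (measure_mono ?_).trans ((measure_union_le _ _).trans (add_le_add hup' hdown'))
  intro u hu
  rw [Set.mem_ofPred_eq, lt_abs] at hu
  rcases hu with h | h
  · exact Or.inl h.le
  · refine Or.inr ?_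
    simp only [Set.mem_ofPred_eq, Function.comp_apply, Finset.sum_neg_distrib]
    exact h.le

/-- Uniform deviation bound: a union bound over the traces of balls, conditionally on the
features. -/
lemma measure_exists_ballTrace_deviation_le {D : ℕ} {ι : Type*} [Fintype ι] {P : Measure (Point D)}
    [IsProbabilityMeasure P] {η : Point D → ℝ}
    (hη : Measurable η) (hη01 : ∀ x, η x ∈ Set.Icc (0 : ℝ) 1) {t : ℝ} (ht : 0 ≤ t) :
    Measure.pi (fun _ : ι => jointLaw P η)
      {S | ∃ T : Finset ι, IsBallTrace (fun i => (S i).1) T ∧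
        √(T.card * t / 2) < |∑ i ∈ T, (labelValue (S i).2 - η (S i).1)|}
      ≤ ENNReal.ofReal ((Fintype.card ι + 1) ^ (D + 2) * (2 * Real.exp (-t))) := by
  classical
  have hX : Measurable fun (S : ι → Point D × Bool) i => (S i).1 :=
    measurable_pi_lambda _ fun i => measurable_fst.comp (measurable_pi_apply i)
  have hmeas : ∀ T : Finset ι, MeasurableSet {S : ι → Point D × Bool |
      IsBallTrace (fun i => (S i).1) T ∧
        √(T.card * t / 2) < |∑ i ∈ T, (labelValue (S i).2 - η (S i).1)|} := by
    intro T
    refine MeasurableSet.inter (hX (isOpen_setOf_isBallTrace T).measurableSet) ?_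
    have : Measurable fun S : ι → Point D × Bool =>
        ∑ i ∈ T, (labelValue (S i).2 - η (S i).1) := by
      refine Finset.measurable_sum _ fun i _ => ?_
      exact ((measurable_of_finite labelValue).comp
        (measurable_snd.comp (measurable_pi_apply i))).sub
          (hη.comp (measurable_fst.comp (measurable_pi_apply i)))
    exact measurableSet_lt measurable_const (continuous_abs.measurable.comp this)
  have hbound : ∀ T : Finset ι, Measure.pi (fun _ : ι => jointLaw P η) {S : ι → Point D × Bool |
      IsBallTrace (fun i => (S i).1) T ∧
        √(T.card * t / 2) < |∑ i ∈ T, (labelValue (S i).2 - η (S i).1)|} ≤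
      ∫⁻ X : ι → Point D, {X : ι → Point D | IsBallTrace X T}.indicator
        (fun _ => ENNReal.ofReal (2 * Real.exp (-t))) X ∂Measure.pi (fun _ : ι => P) := by
    intro T
    rw [pi_jointLaw_apply hη hη01 (hmeas T)]
    refine lintegral_mono fun X => ?_
    by_cases hXT : IsBallTrace X T
    · simp only [Set.mem_ofPred_eq, hXT, true_and, Set.indicator, if_true]
      exact uniform_deviation_le (fun i => hη01 (X i)) T ht
    · simp [hXT]
  have hunion : {S : ι → Point D × Bool | ∃ T : Finset ι, IsBallTrace (fun i => (S i).1) T ∧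
        √(T.card * t / 2) < |∑ i ∈ T, (labelValue (S i).2 - η (S i).1)|} =
      ⋃ T ∈ (Finset.univ : Finset (Finset ι)), {S | IsBallTrace (fun i => (S i).1) T ∧
        √(T.card * t / 2) < |∑ i ∈ T, (labelValue (S i).2 - η (S i).1)|} := by
    ext S; simp
  rw [hunion]
  refine (measure_biUnion_finset_le _ _).trans
    ((Finset.sum_le_sum fun T _ => hbound T).trans ?_)
  rw [← lintegral_finsetSum _ fun T _ =>
    measurable_const.indicator (isOpen_setOf_isBallTrace T).measurableSet]
  calc _ ≤ ∫⁻ _X : ι → Point D, ENNReal.ofReal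
        ((Fintype.card ι + 1) ^ (D + 2) * (2 * Real.exp (-t))) ∂Measure.pi (fun _ : ι => P) := by
        refine lintegral_mono fun X => ?_
        simp only [Set.indicator_apply, Set.mem_ofPred_eq]
        rw [← Finset.sum_filter, Finset.sum_const, nsmul_eq_mul,
          ENNReal.ofReal_mul (p := ((Fintype.card ι : ℝ) + 1) ^ (D + 2)) (by positivity)]
        refine mul_le_mul' ?_ le_rfl
        rw [show ((Fintype.card ι : ℝ) + 1) ^ (D + 2) =
          (((Fintype.card ι + 1) ^ (D + 2) : ℕ) : ℝ) by push_cast; rfl, ENNReal.ofReal_natCast]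
        exact_mod_cast card_ballTrace_le X
    _ = _ := by simp

/-! ### Uniform lower bounds on the number of examples in a ball -/

lemma exists_mass_closedBall_ge {D : ℕ} {𝒳 : Set (Point D)} (h𝒳 : MeasurableSet 𝒳)
    {p : Point D → ℝ≥0∞} (hsupp : SupportRegular 𝒳) (hp0 : 0 < ⨅ x ∈ 𝒳, p x) :
    ∃ c r₀ : ℝ, 0 < c ∧ 0 < r₀ ∧ ∀ x ∈ 𝒳, ∀ r : ℝ, 0 < r → r < r₀ →
      ENNReal.ofReal (c * r ^ D) ≤
        (volume.restrict 𝒳).withDensity p (Metric.closedBall x r) := by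
  obtain ⟨ω, hω, r₀, hr₀, h⟩ := hsupp
  obtain ⟨m, hm0, hm⟩ := ENNReal.lt_iff_exists_nnreal_btwn.1 hp0
  have hm0' : 0 < m := by exact_mod_cast hm0
  set v : ℝ := (volume (Metric.closedBall (0 : Point D) 1)).toReal with hv
  have hvfin : volume (Metric.closedBall (0 : Point D) 1) ≠ ∞ :=
    measure_closedBall_lt_top.ne
  have hvpos : 0 < v := ENNReal.toReal_pos
    (Metric.measure_closedBall_pos volume _ one_pos).ne' hvfin
  refine ⟨m * (ω * v), r₀, by positivity, hr₀, fun x hx r hr hrr => ?_⟩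
  have hmeas : MeasurableSet (𝒳 ∩ Metric.closedBall x r) := h𝒳.inter measurableSet_closedBall
  calc ENNReal.ofReal (m * (ω * v) * r ^ D)
      = m * (ENNReal.ofReal ω * volume (Metric.closedBall x r)) := by
        rw [Measure.addHaar_closedBall' _ _ hr.le, finrank_euclideanSpace_fin,
          ← ENNReal.ofReal_toReal hvfin, ← hv, mul_assoc, ENNReal.ofReal_mul (by positivity),
          ENNReal.ofReal_coe_nnreal, mul_assoc ω, ENNReal.ofReal_mul hω.le, mul_comm v,
          ENNReal.ofReal_mul (by positivity)]
    _ ≤ m * volume (𝒳 ∩ Metric.closedBall x r) := by gcongr; exact h x hx r hr hrr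
    _ = ∫⁻ _ in 𝒳 ∩ Metric.closedBall x r, m := by rw [setLIntegral_const]
    _ ≤ ∫⁻ y in 𝒳 ∩ Metric.closedBall x r, p y := by
        refine setLIntegral_mono' hmeas fun y hy => ?_
        exact hm.le.trans (iInf₂_le y hy.1)
    _ = (volume.restrict 𝒳).withDensity p (𝒳 ∩ Metric.closedBall x r) := by
        rw [withDensity_apply _ hmeas, Measure.restrict_restrict hmeas,
          Set.inter_right_comm, Set.inter_self]
    _ ≤ _ := measure_mono Set.inter_subset_right

open Classical in
/-- Multiplicative Chernoff bound for the lower tail of a binomial count, from the exponential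
moment `E[2 ^ (-count)] = (1 - Q s / 2) ^ n`. -/
lemma pi_card_mem_lt_le {Ω : Type*} [MeasurableSpace Ω] {Q : Measure Ω} [IsProbabilityMeasure Q]
    {ι : Type*} [Fintype ι] {s : Set Ω} (hs : MeasurableSet s) {q : ℝ}
    (hq : ENNReal.ofReal q ≤ Q s) (k : ℕ) :
    Measure.pi (fun _ : ι => Q) {S | (Finset.univ.filter fun i => S i ∈ s).card < k} ≤
      ENNReal.ofReal (Real.exp (k - Fintype.card ι * q / 2)) := by
  set f : Ω → ℝ := fun z => 1 - s.indicator (fun _ => 1 / 2) z with hf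
  have hfS : ∀ S : ι → Ω,
      ∏ i, f (S i) = (1 / 2) ^ (Finset.univ.filter fun i => S i ∈ s).card := by
    intro S
    rw [← Finset.prod_const, Finset.prod_filter]
    refine Finset.prod_congr rfl fun i _ => ?_
    by_cases h : S i ∈ s
    · simp [hf, h]; norm_num
    · simp [hf, h]
  have hfint : ∫ z, f z ∂Q = 1 - Q.real s / 2 := by
    rw [hf, integral_sub (integrable_const _) ((integrable_const _).indicator hs),
      integral_indicator_const _ hs]
    simp [div_eq_mul_inv]
  have hqs : q ≤ Q.real s := by
    rw [measureReal_def]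
    exact (ENNReal.ofReal_le_iff_le_toReal (measure_ne_top _ _)).1 hq
  have hmean : ∫ S : ι → Ω, ∏ i, f (S i) ∂Measure.pi (fun _ => Q) ≤
      Real.exp (-(Fintype.card ι * q / 2)) := by
    rw [integral_fintype_prod_eq_prod (f := fun _ : ι => f), Finset.prod_const, hfint,
      Finset.card_univ]
    have h1 : Q.real s ≤ 1 := measureReal_le_one
    calc (1 - Q.real s / 2) ^ Fintype.card ι ≤ (Real.exp (-(q / 2))) ^ Fintype.card ι := by
          refine pow_le_pow_left₀ (by linarith) ?_ _
          have := Real.add_one_le_exp (-(q / 2))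
          linarith
      _ = _ := by rw [← Real.exp_nat_mul]; ring_nf
  have hnn : 0 ≤ᵐ[Measure.pi fun _ : ι => Q] fun S => ∏ i, f (S i) :=
    Eventually.of_forall fun S => by simp only [hfS]; positivity
  have hfm : Measurable f := measurable_const.sub (measurable_const.indicator hs)
  have hint : Integrable (fun S : ι → Ω => ∏ i, f (S i)) (Measure.pi fun _ => Q) := by
    refine Integrable.of_bound (C := 1) ?_ (Eventually.of_forall fun S => ?_)
    · exact (Finset.measurable_prod _ fun i _ =>
        hfm.comp (measurable_pi_apply i)).aestronglyMeasurable
    · rw [hfS, Real.norm_of_nonneg (by positivity)]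
      exact pow_le_one₀ (by norm_num) (by norm_num)
  have hmarkov := mul_meas_ge_le_integral_of_nonneg hnn hint ((1 / 2) ^ k)
  have hreal : (Measure.pi fun _ : ι => Q).real {S | (1 / 2 : ℝ) ^ k ≤ ∏ i, f (S i)} ≤
      Real.exp (k - Fintype.card ι * q / 2) := by
    have h2 : (2 : ℝ) ^ k ≤ Real.exp k := by
      rw [← mul_one (k : ℝ), Real.exp_nat_mul]
      gcongr
      have := Real.add_one_le_exp (1 : ℝ)
      linarith
    have h3 := mul_le_mul h2 (hmarkov.trans hmean)
      (mul_nonneg (by positivity) measureReal_nonneg) (Real.exp_pos _).le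
    rw [← mul_assoc, ← mul_pow, ← Real.exp_add] at h3
    simpa [sub_eq_add_neg] using h3
  rw [measureReal_def] at hreal
  refine (measure_mono ?_).trans (ENNReal.le_ofReal_iff_toReal_le (measure_ne_top _ _)
    (Real.exp_pos _).le |>.2 hreal)
  intro S hS
  rw [Set.mem_ofPred_eq, hfS]
  exact pow_le_pow_of_le_one (by norm_num) (by norm_num) (le_of_lt hS)

lemma jointLaw_preimage_fst {D : ℕ} {P : Measure (Point D)} [SFinite P] {η : Point D → ℝ}
    (hη : Measurable η) (hη01 : ∀ x, η x ∈ Set.Icc (0 : ℝ) 1) {s : Set (Point D)}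
    (hs : MeasurableSet s) : jointLaw P η (Prod.fst ⁻¹' s) = P s := by
  rw [jointLaw_eq_map hη hη01, Measure.map_apply (measurable_uniformLabel hη) (measurable_fst hs)]
  have : (fun z : Point D × ℝ => (z.1, uniformLabel (η z.1) z.2)) ⁻¹' (Prod.fst ⁻¹' s) =
      s ×ˢ Set.univ := by ext; simp
  rw [this, Measure.prod_prod, measure_univ, mul_one]

lemma isProbabilityMeasure_jointLaw {D : ℕ} {P : Measure (Point D)} [IsProbabilityMeasure P]
    {η : Point D → ℝ} (hη : Measurable η) (hη01 : ∀ x, η x ∈ Set.Icc (0 : ℝ) 1) :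
    IsProbabilityMeasure (jointLaw P η) :=
  ⟨by simpa using jointLaw_preimage_fst (P := P) hη hη01 MeasurableSet.univ⟩

/-- A maximal family of centres at pairwise distances above `2 ρ` has at most `n` members, as the
balls of radius `ρ` around them are disjoint and have mass at least `1 / n` each. -/
lemma exists_finset_cover {D : ℕ} {P : Measure (Point D)} [IsProbabilityMeasure P]
    {𝒳 : Set (Point D)} {ρ : ℝ} {n : ℕ}
    (h : ∀ z ∈ 𝒳, 1 ≤ n * P (Metric.closedBall z ρ)) :
    ∃ Z : Finset (Point D), (Z : Set (Point D)) ⊆ 𝒳 ∧ Z.card ≤ n ∧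
      ∀ x ∈ 𝒳, ∃ z ∈ Z, dist x z ≤ 2 * ρ := by
  classical
  let Q : ℕ → Prop := fun m => ∃ Z : Finset (Point D), (Z : Set (Point D)) ⊆ 𝒳 ∧ Z.card = m ∧
    (Z : Set (Point D)).Pairwise fun z w => 2 * ρ < dist z w
  have hQ : ∀ m, Q m → m ≤ n := by
    rintro m ⟨Z, hZ, rfl, hsep⟩
    have hdisj : (Z : Set (Point D)).PairwiseDisjoint fun z => Metric.closedBall z ρ := by
      intro z hz w hw hzw
      exact Metric.closedBall_disjoint_closedBall (by linarith [hsep hz hw hzw])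
    have h1 : (Z.card : ℝ≥0∞) ≤ n := by
      calc (Z.card : ℝ≥0∞) = ∑ _z ∈ Z, 1 := by simp
        _ ≤ ∑ z ∈ Z, n * P (Metric.closedBall z ρ) :=
          Finset.sum_le_sum fun z hz => h z (hZ hz)
        _ = n * P (⋃ z ∈ Z, Metric.closedBall z ρ) := by
          rw [measure_biUnion_finset hdisj fun _ _ => measurableSet_closedBall, Finset.mul_sum]
        _ ≤ n * 1 := by gcongr; exact prob_le_one
        _ = n := mul_one _
    exact_mod_cast h1
  have hQ0 : Q 0 := ⟨∅, by simp, rfl, by simp⟩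
  obtain ⟨Z, hZ, hcard, hsep⟩ := Nat.findGreatest_spec (Nat.zero_le n) hQ0
  refine ⟨Z, hZ, hcard ▸ Nat.findGreatest_le n, fun x hx => ?_⟩
  by_contra! hfar
  by_cases hxZ : x ∈ Z
  · have h2 := hfar x hxZ
    have h3 : Metric.closedBall x ρ = ∅ := Metric.closedBall_eq_empty.2 (by
      rw [dist_self] at h2; linarith)
    have := h x hx
    simp [h3] at this
  · have hnew : Q (Z.card + 1) := by
      refine ⟨insert x Z, by simp [Set.insert_subset_iff, hx, hZ],
        Finset.card_insert_of_notMem hxZ, ?_⟩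
      rw [Finset.coe_insert]
      refine hsep.insert fun z hz _ => ⟨hfar z hz, ?_⟩
      rw [dist_comm]; exact hfar z hz
    have := Nat.le_findGreatest (hQ _ hnew) hnew
    omega

open Classical in
/-- If balls of radius `ρ` have mass at least `4 k / n`, then with high probability every ball
of radius `3 ρ` contains at least `k` examples. -/
lemma measure_exists_ball_card_lt_le {D n : ℕ} {P : Measure (Point D)}
    [IsProbabilityMeasure P] {η : Point D → ℝ}
    (hη : Measurable η) (hη01 : ∀ x, η x ∈ Set.Icc (0 : ℝ) 1) {𝒳 : Set (Point D)} {ρ : ℝ} {k : ℕ}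
    (hk : 1 ≤ k) (hn : 1 ≤ n)
    (h : ∀ z ∈ 𝒳, ENNReal.ofReal (4 * k / n) ≤ P (Metric.closedBall z ρ)) :
    Measure.pi (fun _ : Fin n => jointLaw P η) {S | ∃ x ∈ 𝒳, (inBall S x (3 * ρ)).card < k} ≤
      ENNReal.ofReal (n * Real.exp (-k)) := by
  have hprob := isProbabilityMeasure_jointLaw (P := P) hη hη01
  have hn0 : (0 : ℝ) < n := by exact_mod_cast hn
  have hk1 : (1 : ℝ) ≤ k := by exact_mod_cast hk
  obtain ⟨Z, hZ, hcard, hcover⟩ := exists_finset_cover (P := P) (𝒳 := 𝒳) (ρ := ρ) (n := n) (by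
    intro z hz
    calc (1 : ℝ≥0∞) ≤ ENNReal.ofReal (n * (4 * k / n)) := by
          rw [ENNReal.one_le_ofReal, mul_div_cancel₀ _ hn0.ne']; linarith
      _ = n * ENNReal.ofReal (4 * k / n) := by
          rw [ENNReal.ofReal_mul hn0.le, ENNReal.ofReal_natCast]
      _ ≤ _ := by gcongr; exact h z hz)
  have hsub : {S : Fin n → Point D × Bool | ∃ x ∈ 𝒳, (inBall S x (3 * ρ)).card < k} ⊆
      ⋃ z ∈ Z, {S | (Finset.univ.filter fun i =>
        S i ∈ Prod.fst ⁻¹' Metric.closedBall z ρ).card < k} := by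
    rintro S ⟨x, hx, hS⟩
    obtain ⟨z, hz, hxz⟩ := hcover x hx
    refine Set.mem_biUnion (Finset.mem_coe.2 hz) (lt_of_le_of_lt (Finset.card_le_card ?_) hS)
    refine Finset.monotone_filter_right _ fun i _ hi => ?_
    simp only [Set.mem_preimage, Metric.mem_closedBall] at hi ⊢
    linarith [dist_triangle (S i).1 z x, dist_comm x z]
  refine (measure_mono hsub).trans ((measure_biUnion_finset_le _ _).trans ?_)
  calc _ ≤ ∑ _z ∈ Z, ENNReal.ofReal (Real.exp (-k)) := by
        refine Finset.sum_le_sum fun z hz => ?_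
        have hball := h z (hZ hz)
        rw [← jointLaw_preimage_fst hη hη01 measurableSet_closedBall] at hball
        refine (pi_card_mem_lt_le (measurable_fst measurableSet_closedBall) hball k).trans ?_
        refine ENNReal.ofReal_le_ofReal (Real.exp_le_exp.2 ?_)
        rw [Fintype.card_fin, mul_div_cancel₀ _ hn0.ne']
        linarith
    _ ≤ _ := by
        rw [Finset.sum_const, nsmul_eq_mul, ENNReal.ofReal_mul hn0.le, ENNReal.ofReal_natCast]
        gcongr

/-- The radius `(4 k / (c n)) ^ (1 / D)` is the one at which the guaranteed mass `c r ^ D` is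
`4 k / n`. The bound is uniform over `k`. -/
lemma measure_exists_card_lt_le {D n : ℕ} (hD : 1 ≤ D) {P : Measure (Point D)}
    [IsProbabilityMeasure P] {η : Point D → ℝ}
    (hη : Measurable η) (hη01 : ∀ x, η x ∈ Set.Icc (0 : ℝ) 1) {𝒳 : Set (Point D)}
    {c r₀ : ℝ} (hc : 0 < c)
    (hmass : ∀ x ∈ 𝒳, ∀ r : ℝ, 0 < r → r < r₀ →
      ENNReal.ofReal (c * r ^ D) ≤ P (Metric.closedBall x r)) (hn : 1 ≤ n) (L : ℝ) :
    Measure.pi (fun _ : Fin n => jointLaw P η)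
      {S | ∃ k : ℕ, 1 ≤ k ∧ k ≤ n ∧ L ≤ k ∧ (4 * k / (c * n)) ^ (1 / (D : ℝ)) < r₀ ∧ ∃ x ∈ 𝒳,
        (inBall S x (3 * (4 * k / (c * n)) ^ (1 / (D : ℝ)))).card < k} ≤
      ENNReal.ofReal (n ^ 2 * Real.exp (-L)) := by
  classical
  have hn0 : (0 : ℝ) < n := by exact_mod_cast hn
  set ρ : ℕ → ℝ := fun k => (4 * k / (c * n)) ^ (1 / (D : ℝ)) with hρ
  set A : ℕ → Set (Fin n → Point D × Bool) := fun k =>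
    {S | L ≤ k ∧ ρ k < r₀ ∧ ∃ x ∈ 𝒳, (inBall S x (3 * ρ k)).card < k} with hA
  have hA_le : ∀ k ∈ Finset.Icc 1 n, Measure.pi (fun _ : Fin n => jointLaw P η) (A k) ≤
      ENNReal.ofReal (n * Real.exp (-L)) := by
    intro k hk
    have hk1 : 1 ≤ k := (Finset.mem_Icc.1 hk).1
    have hk0 : (0 : ℝ) < k := by exact_mod_cast hk1
    by_cases hcond : L ≤ k ∧ ρ k < r₀
    · have hρpow : c * ρ k ^ D = 4 * k / n := by
        rw [hρ]
        simp only
        rw [← Real.rpow_natCast, ← Real.rpow_mul (by positivity), one_div,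
          inv_mul_cancel₀ (by positivity), Real.rpow_one]
        field_simp
      refine ((measure_mono fun S hS => hS.2.2).trans (measure_exists_ball_card_lt_le hη hη01
        (ρ := ρ k) hk1 hn fun z hz => ?_)).trans (ENNReal.ofReal_le_ofReal ?_)
      · rw [← hρpow]
        exact hmass z hz _ (by positivity) hcond.2
      · gcongr
        exact hcond.1
    · have : A k = ∅ := by
        ext S
        simp only [hA, Set.mem_ofPred_eq, Set.mem_empty_iff_false, iff_false]
        exact fun hS => hcond ⟨hS.1, hS.2.1⟩
      simp [this]
  refine (measure_mono (t := ⋃ k ∈ Finset.Icc 1 n, A k) ?_).trans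
    ((measure_biUnion_finset_le _ _).trans ((Finset.sum_le_sum hA_le).trans ?_))
  · rintro S ⟨k, hk1, hkn, hS⟩
    exact Set.mem_biUnion (Finset.mem_coe.2 (Finset.mem_Icc.2 ⟨hk1, hkn⟩)) hS
  · rw [Finset.sum_const, Nat.card_Icc, nsmul_eq_mul, ← ENNReal.ofReal_natCast,
      ← ENNReal.ofReal_mul (by positivity)]
    refine ENNReal.ofReal_le_ofReal (le_of_eq ?_)
    push_cast [Nat.add_sub_cancel]
    ring

/-! ### The `k`-NN prediction on a well-behaved sample -/

/-- The infimum that defines the `k`-NN radius is attained, so the `k`-NN set has at least `k`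
elements as soon as some ball does. -/
lemma kNNRadius_le_and_le_card {D : ℕ} {ι : Type*} [Fintype ι] {S : ι → Point D × Bool} {k : ℕ}
    (hk : 1 ≤ k) {x : Point D} {R : ℝ} (hR : k ≤ (inBall S x R).card) :
    kNNRadius S k x ≤ R ∧ k ≤ (kNNSet S k x).card := by
  classical
  have hbdd : BddBelow {r : ℝ | k ≤ (inBall S x r).card} := by
    refine ⟨0, fun r hr => ?_⟩
    obtain ⟨i, hi⟩ := Finset.card_pos.1 (hk.trans hr)
    exact dist_nonneg.trans (Finset.mem_filter.1 hi).2
  refine ⟨csInf_le hbdd hR, ?_⟩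
  -- finitely many examples: a slightly larger ball contains no further ones
  have hev : ∀ᶠ r in 𝓝 (kNNRadius S k x), inBall S x r ⊆ kNNSet S k x := by
    have h : ∀ᶠ r in 𝓝 (kNNRadius S k x), ∀ i, i ∉ kNNSet S k x → r < dist (S i).1 x := by
      refine eventually_all.2 fun i => ?_
      by_cases hi : i ∈ kNNSet S k x
      · simp [hi]
      · have hlt : kNNRadius S k x < dist (S i).1 x := by
          by_contra! hle
          exact hi (Finset.mem_filter.2 ⟨Finset.mem_univ _, hle⟩)
        filter_upwards [Iio_mem_nhds hlt] with r hr _ using hr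
    filter_upwards [h] with r hr i hi
    by_contra hiN
    exact absurd (hr i hiN) (not_lt.2 (Finset.mem_filter.1 hi).2)
  obtain ⟨ε, hε, hball⟩ := Metric.eventually_nhds_iff.1 hev
  obtain ⟨r, hr, hrlt⟩ := exists_lt_of_csInf_lt ⟨R, hR⟩
    (show sInf {r : ℝ | k ≤ (inBall S x r).card} < kNNRadius S k x + ε by
      rw [kNNRadius]; linarith)
  have hle : kNNRadius S k x ≤ r := csInf_le hbdd hr
  have hdist : dist r (kNNRadius S k x) < ε := by
    rw [Real.dist_eq, abs_of_nonneg (by linarith)]; linarith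
  exact le_trans hr (Finset.card_le_card (hball hdist))

lemma sum_inBall_pooledSample {D n : ℕ} (S : Fin n → Point D × Bool) (C : Finset (Point D))
    (c : C → Bool) (x : Point D) (r : ℝ) (f : Bool → ℝ) :
    ∑ i ∈ inBall (pooledSample S C c) x r, f (pooledSample S C c i).2 =
      ∑ i ∈ inBall S x r, f (S i).2 +
        ∑ j ∈ inBall (fun z : C => ((z : Point D), c z)) x r, f (c j) := by
  classical
  simp only [inBall, Finset.sum_filter, Fintype.sum_sum_type]
  rfl

lemma card_filter_sub_card_filter {D : ℕ} {ι : Type*} (S : ι → Point D × Bool) (N : Finset ι)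
    (b : Bool) :
    ((N.filter fun i => (S i).2 = b).card : ℝ) - (N.filter fun i => (S i).2 = !b).card =
      2 * ∑ i ∈ N, (2 * labelValue b - 1) * (labelValue (S i).2 - 1 / 2) := by
  rw [Finset.card_filter, Finset.card_filter, Nat.cast_sum, Nat.cast_sum,
    ← Finset.sum_sub_distrib, Finset.mul_sum]
  refine Finset.sum_congr rfl fun i _ => ?_
  cases b <;> cases (S i).2 <;> norm_num [labelValue]

/-- The Bayes label `b` wins the vote: the factor `2 * labelValue b - 1` is the sign `±1` for
which `b` is the favourable side. The examples of the ball contribute at least `m Δ / 2` minus the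
deviation, and the at most one corrupted point contributes at least `-1/2`. -/
lemma kNNScore_not_lt_of_margin {D n : ℕ} {η : Point D → ℝ} {S : Fin n → Point D × Bool}
    {C : Finset (Point D)} {c : C → Bool} {k : ℕ} {x : Point D} {R Δ t : ℝ} (hk : 1 ≤ k)
    (hR : k ≤ (inBall S x R).card) (b : Bool)
    (hmargin : ∀ i, (S i).1 ∈ Metric.closedBall x R →
      Δ / 2 ≤ (2 * labelValue b - 1) * (η (S i).1 - 1 / 2))
    (hdev : ∀ T : Finset (Fin n), IsBallTrace (fun i => (S i).1) T →
      |∑ i ∈ T, (labelValue (S i).2 - η (S i).1)| ≤ √(T.card * t / 2))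
    (hC : ∀ z ∈ C, ∀ w ∈ C, z ∈ Metric.closedBall x R → w ∈ Metric.closedBall x R → z = w)
    (hΔ : ∀ m : ℕ, k ≤ m + 1 → √(m * t / 2) + 1 / 2 < m * (Δ / 2)) :
    kNNScore (pooledSample S C c) k x (!b) < kNNScore (pooledSample S C c) k x b := by
  classical
  set W := pooledSample S C c with hW
  have hcardW : ∀ r, (inBall W x r).card = (inBall S x r).card +
      (inBall (fun z : C => ((z : Point D), c z)) x r).card := by
    intro r
    have := sum_inBall_pooledSample S C c x r fun _ => 1
    simp only [Finset.sum_const, nsmul_eq_mul, mul_one] at this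
    exact_mod_cast this
  obtain ⟨hrR, hkN⟩ := kNNRadius_le_and_le_card (S := W) (R := R) hk
    (hR.trans (by rw [hcardW]; omega))
  set r := kNNRadius W k x with hr
  set T := inBall S x r with hT
  set U := inBall (fun z : C => ((z : Point D), c z)) x r with hU
  have hball : Metric.closedBall x r ⊆ Metric.closedBall x R :=
    Metric.closedBall_subset_closedBall hrR
  have hUcard : U.card ≤ 1 := by
    refine Finset.card_le_one.2 fun z hz w hw => Subtype.ext ?_
    exact hC z z.2 w w.2 (hball (Finset.mem_filter.1 hz).2) (hball (Finset.mem_filter.1 hw).2)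
  have hkT : k ≤ T.card + 1 := by
    have h1 : (kNNSet W k x).card = T.card + U.card := hcardW r
    omega
  have hTtrace : IsBallTrace (fun i => (S i).1) T :=
    ⟨x, r, fun i => by simp [hT, inBall]⟩
  have habs : |2 * labelValue b - 1| = 1 := by cases b <;> norm_num [labelValue]
  have hsumT : T.card * (Δ / 2) - √(T.card * t / 2) ≤
      ∑ i ∈ T, (2 * labelValue b - 1) * (labelValue (S i).2 - 1 / 2) := by
    have h1 : ∑ i ∈ T, (2 * labelValue b - 1) * (labelValue (S i).2 - 1 / 2) =
        ∑ i ∈ T, (2 * labelValue b - 1) * (η (S i).1 - 1 / 2) +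
          (2 * labelValue b - 1) * ∑ i ∈ T, (labelValue (S i).2 - η (S i).1) := by
      rw [Finset.mul_sum, ← Finset.sum_add_distrib]
      exact Finset.sum_congr rfl fun i _ => by ring
    have h2 : T.card * (Δ / 2) ≤ ∑ i ∈ T, (2 * labelValue b - 1) * (η (S i).1 - 1 / 2) := by
      rw [← nsmul_eq_mul]
      exact Finset.card_nsmul_le_sum _ _ _ fun i hi =>
        hmargin i (hball (Finset.mem_filter.1 hi).2)
    have h3 : |(2 * labelValue b - 1) * ∑ i ∈ T, (labelValue (S i).2 - η (S i).1)| ≤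
        √(T.card * t / 2) := by
      rw [abs_mul, habs, one_mul]; exact hdev T hTtrace
    rw [h1]
    linarith [(abs_le.1 h3).1]
  have hsumU : -(1 / 2) ≤
      ∑ j ∈ U, (2 * labelValue b - 1) * (labelValue (c j) - 1 / 2) := by
    have h1 : ∀ j ∈ U, -(1 / 2 : ℝ) ≤ (2 * labelValue b - 1) * (labelValue (c j) - 1 / 2) := by
      intro j _
      cases b <;> cases c j <;> norm_num [labelValue]
    have h2 := Finset.card_nsmul_le_sum _ _ _ h1
    have h3 : (U.card : ℝ) ≤ 1 := by exact_mod_cast hUcard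
    rw [nsmul_eq_mul] at h2
    linarith
  have hdiff := card_filter_sub_card_filter W (kNNSet W k x) b
  have hsum := sum_inBall_pooledSample S C c x r fun y =>
    (2 * labelValue b - 1) * (labelValue y - 1 / 2)
  have hsum' : ∑ i ∈ kNNSet W k x, (2 * labelValue b - 1) * (labelValue (W i).2 - 1 / 2) = _ :=
    hsum
  rw [hsum'] at hdiff
  have hNpos : (0 : ℝ) < (kNNSet W k x).card := by exact_mod_cast hk.trans hkN
  unfold kNNScore
  refine div_lt_div_of_pos_right ?_ hNpos
  linarith [hΔ T.card hkT]

lemma IsKNNPrediction.eq_of_kNNScore_lt {D : ℕ} {ι : Type*} [Fintype ι]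
    {S : ι → Point D × Bool} {k : ℕ} {x : Point D} {b ŷ : Bool}
    (h : kNNScore S k x (!b) < kNNScore S k x b)
    (hŷ : IsKNNPrediction S k x ŷ) : ŷ = b := by
  by_contra hne
  obtain rfl : ŷ = !b := by cases ŷ <;> cases b <;> simp_all
  exact absurd (hŷ b) (not_le.2 h)

/-! ### Asymptotics of the margin rate -/

lemma eventually_lower_bound_le {α d A : ℝ} (hα : 0 < α) (hd : 0 < d) {k : ℕ → ℕ}
    (hk : (fun n : ℕ => (k n : ℝ)) =Θ[atTop] fun n : ℕ => (n : ℝ) ^ (2 * α / (2 * α + d))) :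
    ∀ᶠ n : ℕ in atTop, A * (n : ℝ) ^ (α / (α + d)) ≤ k n := by
  have hlt : α / (α + d) < 2 * α / (2 * α + d) := by
    rw [div_lt_div_iff₀ (by positivity) (by positivity)]
    nlinarith [mul_pos hα hd]
  obtain ⟨a, ha, hlow⟩ := hk.2.exists_pos
  have hlarge : ∀ᶠ n : ℕ in atTop, a * A ≤ (n : ℝ) ^ (2 * α / (2 * α + d) - α / (α + d)) :=
    ((tendsto_rpow_atTop (sub_pos.2 hlt)).comp tendsto_natCast_atTop_atTop).eventually_ge_atTop _
  filter_upwards [hlow.bound, hlarge, eventually_ge_atTop 1] with n hl hn hn1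
  have hn0 : (0 : ℝ) < n := by exact_mod_cast hn1
  rw [Real.norm_of_nonneg (by positivity), Real.norm_of_nonneg (Nat.cast_nonneg _)] at hl
  refine le_of_mul_le_mul_left ?_ ha
  calc a * (A * (n : ℝ) ^ (α / (α + d))) = a * A * (n : ℝ) ^ (α / (α + d)) := by ring
    _ ≤ (n : ℝ) ^ (2 * α / (2 * α + d) - α / (α + d)) * (n : ℝ) ^ (α / (α + d)) := by gcongr
    _ = (n : ℝ) ^ (2 * α / (2 * α + d)) := by rw [← Real.rpow_add hn0, sub_add_cancel]
    _ ≤ a * k n := hl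

lemma marginRate_isBigO {D : ℕ} (hD : 1 ≤ D) {α : ℝ} (hα : 0 < α) (K δ : ℝ) {k : ℕ → ℕ}
    (hk : (fun n : ℕ => (k n : ℝ)) =Θ[atTop] fun n : ℕ => (n : ℝ) ^ (2 * α / (2 * α + D))) :
    (fun n : ℕ => marginRate D α K δ n (k n)) =O[atTop]
      fun n : ℕ => (n : ℝ) ^ (-α / (2 * α + D)) * Real.log n ^ 1 := by
  have hd : (0 : ℝ) < D := by exact_mod_cast hD
  obtain ⟨a, ha, hlow⟩ := hk.2.exists_pos
  obtain ⟨b, hb, hup⟩ := hk.1.exists_pos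
  have hlog : ∀ᶠ n : ℕ in atTop, max 1 (Real.log (1 / δ)) ≤ Real.log n :=
    (Real.tendsto_log_atTop.comp tendsto_natCast_atTop_atTop).eventually_ge_atTop _
  refine IsBigO.const_mul_left ?_ K
  refine IsBigO.of_bound (√(2 * a) + b ^ (α / D)) ?_
  filter_upwards [hlow.bound, hup.bound, hlog, eventually_ge_atTop 1] with n hl hu hln hn
  have hn0 : (0 : ℝ) < n := by exact_mod_cast hn
  set e : ℝ := (n : ℝ) ^ (-α / (2 * α + D)) with he
  have he0 : 0 < e := by positivity
  set q : ℝ := (n : ℝ) ^ (2 * α / (2 * α + D)) with hq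
  have hq0 : 0 < q := by positivity
  have hqe : e ^ 2 * q = 1 := by
    rw [he, hq, ← Real.rpow_natCast, ← Real.rpow_mul hn0.le, ← Real.rpow_add hn0,
      show -α / (2 * α + D) * ((2 : ℕ) : ℝ) + 2 * α / (2 * α + D) = 0 by push_cast; ring,
      Real.rpow_zero]
  rw [Real.norm_of_nonneg hq0.le, Real.norm_of_nonneg (Nat.cast_nonneg _)] at hl hu
  have hk0 : (0 : ℝ) < k n := by
    by_contra! h
    nlinarith
  have h1 : 1 ≤ Real.log n := (le_max_left _ _).trans hln
  have h2 : Real.log (1 / δ) ≤ Real.log n := (le_max_right _ _).trans hln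
  have hfirst : √((Real.log n + Real.log (1 / δ)) / k n) ≤ √(2 * a) * (e * Real.log n) := by
    have h3 : (Real.log n + Real.log (1 / δ)) / k n ≤ 2 * a * (e * Real.log n) ^ 2 := by
      rw [div_le_iff₀ hk0]
      have h4 : 1 ≤ a * e ^ 2 * k n := by
        rw [← hqe]; nlinarith [pow_pos he0 2]
      have h5 : Real.log n ≤ Real.log n ^ 2 := by nlinarith
      nlinarith [mul_le_mul h5 h4 zero_le_one (by positivity)]
    calc _ ≤ √(2 * a * (e * Real.log n) ^ 2) := Real.sqrt_le_sqrt h3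
      _ = _ := by rw [Real.sqrt_mul (by positivity), Real.sqrt_sq (by positivity)]
  have hsecond : ((k n : ℝ) / n) ^ (α / D) ≤ b ^ (α / D) * (e * Real.log n) := by
    have h3 : (k n : ℝ) / n ≤ b * (q / n) := by
      rw [← mul_div_assoc]; gcongr
    have h4 : (q / n) ^ (α / D) = e := by
      rw [hq, ← Real.rpow_sub_one hn0.ne', ← Real.rpow_mul hn0.le, he]
      congr 1
      field_simp
      ring
    calc _ ≤ (b * (q / n)) ^ (α / D) := by gcongr
      _ = b ^ (α / D) * e := by rw [Real.mul_rpow hb.le (by positivity), h4]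
      _ ≤ _ := by gcongr; nlinarith
  rw [Real.norm_of_nonneg (by positivity), Real.norm_of_nonneg (by positivity), pow_one, add_mul]
  exact add_le_add hfirst hsecond

/-! ### The good event and the choice of constants -/

/-- With `t = (2 D + 7) (log n + log (1/δ))` the union bound over at most `(n + 1) ^ (D + 2)` traces
leaves a failure probability of at most `2 δ / n ^ 3`; the bounds on the number of examples in balls
fail with probability at most `δ / n ^ 2`. -/
lemma failure_probability_le {D n : ℕ} (hn : 2 ≤ n) {δ : ℝ} (hδ : 0 < δ) (hδ1 : δ < 1) :
    (n + 1 : ℝ) ^ (D + 2) *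
        (2 * Real.exp (-((2 * D + 7) * (Real.log n + Real.log (1 / δ))))) +
      n ^ 2 * Real.exp (-(4 * (Real.log n + Real.log (1 / δ)))) ≤ δ := by
  have hn2 : (2 : ℝ) ≤ n := by exact_mod_cast hn
  have hn0 : (0 : ℝ) < n := by linarith
  have hexp : ∀ m : ℕ, Real.exp (-(m * (Real.log n + Real.log (1 / δ)))) = (δ / n) ^ m := by
    intro m
    rw [← mul_neg, Real.exp_nat_mul, neg_add, one_div, Real.log_inv, neg_neg, Real.exp_add,
      Real.exp_neg, Real.exp_log hn0, Real.exp_log hδ]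
    congr 1
    field_simp
  have h1 := hexp (2 * D + 7)
  have h2 := hexp 4
  push_cast at h1 h2
  rw [h1, h2]
  have hpow : ∀ m : ℕ, 1 ≤ m → δ ^ m ≤ δ := fun m hm => by
    simpa using pow_le_pow_of_le_one hδ.le hδ1.le hm
  -- `n + 1 ≤ n ^ 2` because `2 ≤ n`
  have hbase : (n + 1 : ℝ) ^ (D + 2) ≤ n ^ (2 * D + 4) := by
    rw [show 2 * D + 4 = 2 * (D + 2) by ring, pow_mul]
    gcongr
    nlinarith
  have hA : (n + 1 : ℝ) ^ (D + 2) * (2 * (δ / n) ^ (2 * D + 7)) ≤ δ / 4 := by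
    calc _ ≤ (n : ℝ) ^ (2 * D + 4) * (2 * (δ / n) ^ (2 * D + 7)) := by gcongr
      _ = 2 * δ ^ (2 * D + 7) / n ^ 3 := by
        rw [div_pow, show (n : ℝ) ^ (2 * D + 7) = n ^ (2 * D + 4) * n ^ 3 by ring]
        field_simp
      _ ≤ 2 * δ / 2 ^ 3 := by
        gcongr
        exact hpow _ (by omega)
      _ = δ / 4 := by ring
  have hB : (n : ℝ) ^ 2 * (δ / n) ^ 4 ≤ δ / 4 := by
    calc _ = δ ^ 4 / (n : ℝ) ^ 2 := by field_simp
      _ ≤ δ / 2 ^ 2 := by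
        gcongr
        exact hpow _ (by omega)
      _ = δ / 4 := by ring
  linarith

/-- The event is the complement of a measurable hull of the bad set, whose measurability is
therefore never needed. -/
lemma exists_good_event {D n : ℕ} (hD : 1 ≤ D) (hn : 2 ≤ n) {P : Measure (Point D)}
    [IsProbabilityMeasure P] {η : Point D → ℝ} (hη : Measurable η)
    (hη01 : ∀ x, η x ∈ Set.Icc (0 : ℝ) 1) {𝒳 : Set (Point D)} (h𝒳 : MeasurableSet 𝒳)
    (hP𝒳 : P 𝒳ᶜ = 0) {c r₀ : ℝ} (hc : 0 < c)
    (hmass : ∀ x ∈ 𝒳, ∀ r : ℝ, 0 < r → r < r₀ →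
      ENNReal.ofReal (c * r ^ D) ≤ P (Metric.closedBall x r))
    {δ : ℝ} (hδ : 0 < δ) (hδ1 : δ < 1) :
    ∃ E : Set (Fin n → Point D × Bool), MeasurableSet E ∧
      ENNReal.ofReal (1 - δ) ≤ Measure.pi (fun _ : Fin n => jointLaw P η) E ∧
      ∀ S ∈ E, (∀ i, (S i).1 ∈ 𝒳) ∧
        (∀ T : Finset (Fin n), IsBallTrace (fun i => (S i).1) T →
          |∑ i ∈ T, (labelValue (S i).2 - η (S i).1)| ≤
            √(T.card * ((2 * D + 7) * (Real.log n + Real.log (1 / δ))) / 2)) ∧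
        ∀ k : ℕ, 1 ≤ k → k ≤ n → 4 * (Real.log n + Real.log (1 / δ)) ≤ k →
          (4 * k / (c * n)) ^ (1 / (D : ℝ)) < r₀ →
          ∀ x ∈ 𝒳, k ≤ (inBall S x (3 * (4 * k / (c * n)) ^ (1 / (D : ℝ)))).card := by
  have hprob := isProbabilityMeasure_jointLaw (P := P) hη hη01
  set μ := Measure.pi (fun _ : Fin n => jointLaw P η) with hμ
  set ℓ := Real.log n + Real.log (1 / δ) with hℓ
  have hℓ0 : 0 ≤ ℓ := add_nonneg (Real.log_natCast_nonneg n)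
    (Real.log_nonneg (one_le_one_div hδ hδ1.le))
  set B₁ : Set (Fin n → Point D × Bool) := {S | ∃ T : Finset (Fin n),
    IsBallTrace (fun i => (S i).1) T ∧ √(T.card * ((2 * D + 7) * ℓ) / 2) <
      |∑ i ∈ T, (labelValue (S i).2 - η (S i).1)|} with hB₁
  set B₂ : Set (Fin n → Point D × Bool) := {S | ∃ k : ℕ, 1 ≤ k ∧ k ≤ n ∧ 4 * ℓ ≤ k ∧
    (4 * k / (c * n)) ^ (1 / (D : ℝ)) < r₀ ∧ ∃ x ∈ 𝒳,
      (inBall S x (3 * (4 * k / (c * n)) ^ (1 / (D : ℝ)))).card < k} with hB₂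
  set B₃ : Set (Fin n → Point D × Bool) := ⋃ i, {S | (S i).1 ∈ 𝒳ᶜ} with hB₃
  have h₁ : μ B₁ ≤ _ := measure_exists_ballTrace_deviation_le hη hη01 (by positivity)
  have h₂ : μ B₂ ≤ _ := measure_exists_card_lt_le hD hη hη01 hc hmass (by omega) (4 * ℓ)
  have h₃ : μ B₃ = 0 := by
    refine measure_iUnion_null fun i => ?_
    have h := (measurePreserving_eval (fun _ : Fin n => jointLaw P η) i).measure_preimage
      (measurable_fst h𝒳.compl).nullMeasurableSet
    rw [jointLaw_preimage_fst hη hη01 h𝒳.compl, hP𝒳] at h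
    exact h
  have hbad : μ (B₁ ∪ B₂ ∪ B₃) ≤ ENNReal.ofReal δ := by
    calc μ (B₁ ∪ B₂ ∪ B₃) ≤ μ B₁ + μ B₂ + μ B₃ :=
          (measure_union_le _ _).trans (add_le_add (measure_union_le _ _) le_rfl)
      _ ≤ _ := by
        rw [h₃, add_zero]
        refine (add_le_add h₁ h₂).trans ?_
        rw [← ENNReal.ofReal_add (by positivity) (by positivity), Fintype.card_fin]
        exact ENNReal.ofReal_le_ofReal (failure_probability_le hn hδ hδ1)
  refine ⟨(toMeasurable μ (B₁ ∪ B₂ ∪ B₃))ᶜ, (measurableSet_toMeasurable _ _).compl, ?_, ?_⟩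
  · rw [prob_compl_eq_one_sub (measurableSet_toMeasurable _ _), measure_toMeasurable,
      ENNReal.ofReal_sub _ hδ.le, ENNReal.ofReal_one]
    exact tsub_le_tsub_left hbad _
  · intro S hS
    have hS' : S ∉ B₁ ∪ B₂ ∪ B₃ := fun h => hS (subset_toMeasurable _ _ h)
    simp only [Set.mem_union, not_or] at hS'
    obtain ⟨⟨hS₁, hS₂⟩, hS₃⟩ := hS'
    refine ⟨fun i => ?_, fun T hT => ?_, fun k hk1 hkn hkℓ hkr x hx => ?_⟩
    · by_contra hi
      exact hS₃ (Set.mem_iUnion.2 ⟨i, hi⟩)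
    · by_contra! hlt
      exact hS₁ ⟨T, hT, hlt⟩
    · by_contra! hlt
      exact hS₂ ⟨k, hk1, hkn, hkℓ, hkr, x, hx, hlt⟩

/-- Margins are at most `1/2`, so the first term of the margin rate bounds `k` from below. -/
lemma four_mul_sq_mul_le_of_marginRate_le {D n k : ℕ} {α K δ : ℝ} (hk : 1 ≤ k) (hK : 0 < K)
    (h : marginRate D α K δ n k ≤ 1 / 2) :
    4 * K ^ 2 * (Real.log n + Real.log (1 / δ)) ≤ k := by
  have hk0 : (0 : ℝ) < k := by exact_mod_cast hk
  have hpow : (0 : ℝ) ≤ ((k : ℝ) / n) ^ (α / D) := by positivity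
  have h1 : √((Real.log n + Real.log (1 / δ)) / k) ≤ 1 / (2 * K) := by
    rw [le_div_iff₀ (by positivity)]
    unfold marginRate at h
    nlinarith [mul_nonneg hK.le hpow]
  have h2 := (Real.sqrt_le_left (by positivity)).1 h1
  rw [div_le_iff₀ hk0] at h2
  have h3 := mul_le_mul_of_nonneg_left h2 (by positivity : 0 ≤ 4 * K ^ 2)
  calc _ ≤ _ := h3
    _ = k := by field_simp; ring

/-- Margins are at most `1/2`, so the second term of the margin rate bounds `k / n` from above. -/
lemma rpow_le_of_marginRate_le {D n k : ℕ} {α K δ : ℝ} (hK : 0 < K)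
    (h : marginRate D α K δ n k ≤ 1 / 2) : ((k : ℝ) / n) ^ (α / D) ≤ 1 / (2 * K) := by
  rw [le_div_iff₀ (by positivity)]
  unfold marginRate at h
  nlinarith [mul_nonneg hK.le (Real.sqrt_nonneg ((Real.log n + Real.log (1 / δ)) / k))]

lemma lt_of_marginRate_le {D n k : ℕ} (hD : 1 ≤ D) {α K δ : ℝ} (hα : 0 < α) (hn : 1 ≤ n)
    (hK : 1 ≤ K) (h : marginRate D α K δ n k ≤ 1 / 2) : k < n := by
  have hn0 : (0 : ℝ) < n := by exact_mod_cast hn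
  by_contra! hle
  have h1 : (1 : ℝ) ≤ (k : ℝ) / n := by
    rw [le_div_iff₀ hn0, one_mul]; exact_mod_cast hle
  have h2 := Real.one_le_rpow h1 (by positivity : 0 ≤ α / D)
  have h3 := rpow_le_of_marginRate_le (by linarith) h
  have h4 : 1 / (2 * K) ≤ 1 / 2 := by gcongr; linarith
  linarith

/-- The mean majority beats the deviation and one corrupted vote. Here `m ≥ k - 1` counts the
uncorrupted examples in the `k`-NN ball. -/
lemma sqrt_add_half_lt {a K ℓ Δ : ℝ} {k m : ℕ} (ha : 1 ≤ a) (hK : 2 * a + 3 ≤ K)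
    (hℓ : 1 / 2 ≤ ℓ) (hk : 4 * K ^ 2 * ℓ ≤ k) (hΔ : K * √(ℓ / k) ≤ Δ) (hkm : k ≤ m + 1) :
    √(m * (a * ℓ) / 2) + 1 / 2 < m * (Δ / 2) := by
  have hkm' : (k : ℝ) ≤ m + 1 := by exact_mod_cast hkm
  have hk2 : (2 : ℝ) ≤ k := by nlinarith
  have hm1 : (1 : ℝ) ≤ m := by linarith
  set s := √(m * ℓ / 2) with hs
  have hs1 : 1 / 2 ≤ s := by
    apply Real.le_sqrt_of_sq_le
    nlinarith
  have hsa : √(m * (a * ℓ) / 2) ≤ a * s := by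
    rw [show m * (a * ℓ) / 2 = a * (m * ℓ / 2) by ring, Real.sqrt_mul (by linarith)]
    gcongr
    exact Real.sqrt_le_iff.2 ⟨by linarith, by nlinarith⟩
  have hsm : s ≤ m * √(ℓ / k) := by
    have h1 : s = m * √(ℓ / (2 * m)) := by
      rw [← Real.sqrt_sq (by linarith : (0 : ℝ) ≤ m), ← Real.sqrt_mul (by positivity), hs,
        Real.sqrt_sq (by linarith : (0 : ℝ) ≤ m)]
      congr 1
      field_simp
    rw [h1]
    gcongr
    linarith
  have h2 : K * s ≤ m * Δ := by
    calc K * s ≤ K * (m * √(ℓ / k)) := by gcongr; linarith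
      _ = m * (K * √(ℓ / k)) := by ring
      _ ≤ m * Δ := by gcongr
  nlinarith

/-- The points of `C` are too far apart for two of them to lie in one ball of radius `R`. -/
lemma eq_of_mem_closedBall_of_le_minPairwiseDist {D n k : ℕ} {C : Finset (Point D)} {c : ℝ}
    {x : Point D} {R : ℝ} (hR0 : 0 ≤ R) (hc : 0 ≤ c) (hR : c * (2 * R) ^ D * n < k)
    (h : (k : ℝ≥0∞) ≤ ENNReal.ofReal c * minPairwiseDist (C : Set (Point D)) ^ D * n) :
    ∀ z ∈ C, ∀ w ∈ C, z ∈ Metric.closedBall x R → w ∈ Metric.closedBall x R → z = w := by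
  intro z hz w hw hzx hwx
  by_contra hne
  have hsep : minPairwiseDist (C : Set (Point D)) ≤ ENNReal.ofReal (2 * R) := by
    refine (Set.einfsep_le_edist_of_mem (Finset.mem_coe.2 hz) (Finset.mem_coe.2 hw) hne).trans ?_
    rw [edist_dist]
    refine ENNReal.ofReal_le_ofReal ?_
    linarith [dist_triangle_right z w x, Metric.mem_closedBall.1 hzx, Metric.mem_closedBall.1 hwx]
  have h1 : (k : ℝ≥0∞) ≤ ENNReal.ofReal (c * (2 * R) ^ D * n) := by
    calc (k : ℝ≥0∞) ≤ ENNReal.ofReal c * ENNReal.ofReal (2 * R) ^ D * n :=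
          h.trans (by gcongr)
      _ = _ := by
        rw [ENNReal.ofReal_mul (p := c * (2 * R) ^ D) (by positivity), ENNReal.ofReal_mul hc,
          ENNReal.ofReal_pow (by positivity : 0 ≤ 2 * R), ENNReal.ofReal_natCast]
  rw [← ENNReal.ofReal_natCast, ENNReal.ofReal_le_ofReal_iff (by positivity)] at h1
  linarith

lemma le_mul_of_mem_interiorRegion {D : ℕ} {𝒳 : Set (Point D)} {η : Point D → ℝ} {Δ : ℝ}
    {x : Point D} (hx : x ∈ interiorRegion 𝒳 η Δ) :
    Δ ≤ (2 * labelValue (bayesLabel η x) - 1) * (η x - 1 / 2) := by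
  have h := hx.2
  by_cases hle : 1 / 2 ≤ η x
  · rw [abs_sub_comm, abs_of_nonneg (by linarith)] at h
    simp only [bayesLabel, hle, labelValue]
    norm_num at h ⊢
    linarith
  · rw [abs_of_pos (by linarith)] at h
    simp only [bayesLabel, hle, labelValue]
    norm_num at h ⊢
    linarith

lemma jointLaw_congr {D : ℕ} {P : Measure (Point D)} {η η' : Point D → ℝ} (h : η =ᵐ[P] η') :
    jointLaw P η = jointLaw P η' := by
  unfold jointLaw
  congr 2
  · exact withDensity_congr_ae (h.fun_comp fun y => ENNReal.ofReal y)
  · exact withDensity_congr_ae (h.fun_comp fun y => ENNReal.ofReal (1 - y))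

/-- On a sample from the good event, every `k`-NN prediction in the interior region is the Bayes
label. -/
lemma kNN_eq_bayesLabel {D n : ℕ} (hD : 1 ≤ D) (hn : 2 ≤ n) {𝒳 : Set (Point D)}
    {η : Point D → ℝ} (hη01 : ∀ x ∈ 𝒳, η x ∈ Set.Icc (0 : ℝ) 1) {α Cα : ℝ} (hα : 0 < α)
    (hCα : 0 < Cα) (hHolder : ∀ x ∈ 𝒳, ∀ x' ∈ 𝒳, |η x - η x'| ≤ Cα * ‖x - x'‖ ^ α)
    {c r₀ K δ : ℝ} (hc : 0 < c) (hr₀ : 0 < r₀) (hδ : 0 < δ) (hδ1 : δ < 1)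
    (hK₁ : 2 * (2 * D + 7) + 3 ≤ K) (hK₂ : 2 * Cα * (3 * (4 / c) ^ (1 / (D : ℝ))) ^ α ≤ K)
    (hK₃ : ((4 / c) ^ (1 / (D : ℝ)) / r₀) ^ α ≤ K)
    {S : Fin n → Point D × Bool} (hS𝒳 : ∀ i, (S i).1 ∈ 𝒳)
    (hSdev : ∀ T : Finset (Fin n), IsBallTrace (fun i => (S i).1) T →
      |∑ i ∈ T, (labelValue (S i).2 - η (S i).1)| ≤
        √(T.card * ((2 * D + 7) * (Real.log n + Real.log (1 / δ))) / 2))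
    (hScard : ∀ k : ℕ, 1 ≤ k → k ≤ n → 4 * (Real.log n + Real.log (1 / δ)) ≤ k →
      (4 * k / (c * n)) ^ (1 / (D : ℝ)) < r₀ →
      ∀ x ∈ 𝒳, k ≤ (inBall S x (3 * (4 * k / (c * n)) ^ (1 / (D : ℝ)))).card)
    {C : Finset (Point D)} {l : C → Bool} {k : ℕ} (hk : 1 ≤ k)
    (hkC : (k : ℝ≥0∞) ≤
      ENNReal.ofReal (c / (8 * 6 ^ D)) * minPairwiseDist (C : Set (Point D)) ^ D * n)
    {x : Point D} (hx : x ∈ interiorRegion 𝒳 η (marginRate D α K δ n k)) {ŷ : Bool}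
    (hŷ : IsKNNPrediction (pooledSample S C l) k x ŷ) : ŷ = bayesLabel η x := by
  have hD0 : (0 : ℝ) < D := by exact_mod_cast hD
  have hn0 : (0 : ℝ) < n := by positivity
  have hk0 : (0 : ℝ) < k := by exact_mod_cast hk
  have hK0 : 0 < K := by linarith
  set Δ := marginRate D α K δ n k with hΔ
  set ℓ := Real.log n + Real.log (1 / δ) with hℓ
  have hℓ2 : 1 / 2 ≤ ℓ := by
    have h1 : Real.log 2 ≤ Real.log n := Real.log_le_log two_pos (by exact_mod_cast hn)
    have h2 : 0 ≤ Real.log (1 / δ) := Real.log_nonneg (one_le_one_div hδ hδ1.le)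
    linarith [Real.log_two_gt_d9]
  have hΔ2 : Δ ≤ 1 / 2 := by
    refine hx.2.trans (abs_le.2 ?_)
    have := hη01 x hx.1
    exact ⟨by linarith [this.2], by linarith [this.1]⟩
  have hkℓ := four_mul_sq_mul_le_of_marginRate_le hk hK0 hΔ2
  have hkn := lt_of_marginRate_le hD hα (by omega) (by linarith) hΔ2
  have hu := rpow_le_of_marginRate_le hK0 hΔ2
  set B : ℝ := (4 / c) ^ (1 / (D : ℝ)) with hB
  set u : ℝ := ((k : ℝ) / n) ^ (1 / (D : ℝ)) with hu_def
  have hB0 : 0 < B := by positivity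
  have hu0 : 0 < u := by positivity
  have huα : u ^ α = ((k : ℝ) / n) ^ (α / D) := by
    rw [hu_def, ← Real.rpow_mul (by positivity)]; congr 1; ring
  have hρ : (4 * k / (c * n)) ^ (1 / (D : ℝ)) = B * u := by
    rw [hB, hu_def, ← Real.mul_rpow (by positivity) (by positivity)]
    congr 1
    field_simp
  -- `B * u` is the radius `ρ` at which the guaranteed mass is `4 k / n`
  have hρr : B * u < r₀ := by
    rw [← div_lt_one hr₀, mul_div_right_comm]
    refine (Real.rpow_lt_rpow_iff (by positivity) zero_le_one hα).1 ?_
    rw [Real.one_rpow, Real.mul_rpow (by positivity) hu0.le, huα]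
    calc _ ≤ K * (1 / (2 * K)) := by gcongr
      _ < 1 := by field_simp; norm_num
  have hkℓ' : 4 * ℓ ≤ k := by
    have h1 : 1 ≤ K ^ 2 := one_le_pow₀ (by linarith)
    have h2 : ℓ ≤ K ^ 2 * ℓ := le_mul_of_one_le_left (by linarith) h1
    linarith
  have hcard := hScard k hk hkn.le hkℓ' (hρ ▸ hρr) x hx.1
  rw [hρ] at hcard
  set R := 3 * (B * u) with hR
  have hRα : Cα * R ^ α ≤ Δ / 2 := by
    have h1 : K * ((k : ℝ) / n) ^ (α / D) ≤ Δ := by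
      rw [hΔ, marginRate]
      gcongr
      exact le_add_of_nonneg_left (Real.sqrt_nonneg _)
    rw [hR, ← mul_assoc, Real.mul_rpow (by positivity) hu0.le, huα]
    have h2 : (0 : ℝ) ≤ ((k : ℝ) / n) ^ (α / D) := by positivity
    nlinarith [mul_le_mul_of_nonneg_right hK₂ h2]
  have hb : |2 * labelValue (bayesLabel η x) - 1| = 1 := by
    cases bayesLabel η x <;> norm_num [labelValue]
  refine IsKNNPrediction.eq_of_kNNScore_lt
    (kNNScore_not_lt_of_margin (η := η) (R := R) (Δ := Δ)
    (t := (2 * D + 7) * ℓ) hk hcard _ ?_ hSdev ?_ ?_) hŷ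
  · intro i hi
    have h1 : |η (S i).1 - η x| ≤ Δ / 2 := by
      refine (hHolder _ (hS𝒳 i) x hx.1).trans (le_trans ?_ hRα)
      gcongr
      exact mem_closedBall_iff_norm.1 hi
    have h2 := le_mul_of_mem_interiorRegion hx
    have h3 : |(2 * labelValue (bayesLabel η x) - 1) * (η (S i).1 - η x)| ≤ Δ / 2 := by
      rwa [abs_mul, hb, one_mul]
    have h4 := (abs_le.1 h3).1
    linarith
  · refine eq_of_mem_closedBall_of_le_minPairwiseDist (by positivity) (by positivity) ?_ hkC
    have h1 : (B * u) ^ D = 4 * k / (c * n) := by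
      rw [← hρ, ← Real.rpow_natCast, ← Real.rpow_mul (by positivity), one_div,
        inv_mul_cancel₀ hD0.ne', Real.rpow_one]
    rw [hR, show 2 * (3 * (B * u)) = 6 * (B * u) by ring, mul_pow, h1]
    have h2 : c / (8 * 6 ^ D) * (6 ^ D * (4 * k / (c * n))) * n = (k : ℝ) / 2 := by
      field_simp; ring
    linarith
  · intro m hm
    refine sqrt_add_half_lt (by linarith) hK₁ hℓ2 hkℓ ?_ hm
    rw [hΔ, marginRate]
    gcongr
    exact le_add_of_nonneg_right (by positivity)

end DeepKNN

theorem theorem2 {D : ℕ} (hD : 1 ≤ D) (𝒳 : Set (Point D)) (h𝒳 : IsCompact 𝒳)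
    (P : Measure (Point D)) [IsProbabilityMeasure P]
    (p : Point D → ℝ≥0∞) (hp : Measurable p) (hP : P = (volume.restrict 𝒳).withDensity p)
    (η : Point D → ℝ) (hη : Measurable η) (hη01 : ∀ x ∈ 𝒳, η x ∈ Set.Icc (0 : ℝ) 1)
    (hsupp : SupportRegular 𝒳)
    (hp0 : 0 < ⨅ x ∈ 𝒳, p x)
    (α : ℝ) (hα0 : 0 < α) (hα1 : α ≤ 1) (hHolder : HolderContinuousOn α η 𝒳) :
    ∃ Kl Ku K : ℝ, 0 < Kl ∧ 0 < Ku ∧ 0 < K ∧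
      (∀ δ : ℝ, 0 < δ → ∀ n : ℕ, 1 ≤ n →
        ∃ E : Set (Fin n → Point D × Bool), MeasurableSet E ∧
          ENNReal.ofReal (1 - δ) ≤ Measure.pi (fun _ : Fin n => jointLaw P η) E ∧
          ∀ S ∈ E, ∀ C : Finset (Point D), (C : Set (Point D)) ⊆ 𝒳 → ∀ c : C → Bool, ∀ k : ℕ,
            Kl * Real.log (1 / δ) ^ 2 * (n : ℝ) ^ (α / (α + D)) ≤ k →
            (k : ℝ≥0∞) ≤ ENNReal.ofReal Ku * minPairwiseDist (C : Set (Point D)) ^ D * n →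
            ∀ x ∈ interiorRegion 𝒳 η (marginRate D α K δ n k),
              ∀ ŷ : Bool, IsKNNPrediction (pooledSample S C c) k x ŷ →
                ∀ y : Bool, ŷ = y ↔ y = bayesLabel η x) ∧
      (∀ δ : ℝ, 0 < δ → ∀ k : ℕ → ℕ,
        (fun n : ℕ => (k n : ℝ)) =Θ[atTop] (fun n : ℕ => (n : ℝ) ^ (2 * α / (2 * α + D))) →
        (∀ᶠ n : ℕ in atTop, Kl * Real.log (1 / δ) ^ 2 * (n : ℝ) ^ (α / (α + D)) ≤ k n) ∧
        ∃ m : ℕ, (fun n : ℕ => marginRate D α K δ n (k n)) =O[atTop]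
          (fun n : ℕ => (n : ℝ) ^ (-α / (2 * α + D)) * Real.log n ^ m)) := by
  have hD0 : (0 : ℝ) < D := by exact_mod_cast hD
  have hm𝒳 : MeasurableSet 𝒳 := h𝒳.measurableSet
  obtain ⟨Cα, hCα, hHolder⟩ := hHolder
  obtain ⟨c, r₀, hc, hr₀, hmass⟩ := exists_mass_closedBall_ge hm𝒳 hsupp hp0
  rw [← hP] at hmass
  have hP𝒳 : P 𝒳ᶜ = 0 := by
    rw [hP]
    exact withDensity_absolutelyContinuous _ _
      (by rw [Measure.restrict_apply hm𝒳.compl, Set.compl_inter_self, measure_empty])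
  -- `η` is unconstrained outside `𝒳`; clipping it there changes neither the law nor `η` on `𝒳`
  set η' : Point D → ℝ := fun x => max 0 (min 1 (η x)) with hη'
  have hη'm : Measurable η' := measurable_const.max (measurable_const.min hη)
  have hη'01 : ∀ x, η' x ∈ Set.Icc (0 : ℝ) 1 := fun x =>
    ⟨le_max_left _ _, max_le zero_le_one (min_le_left _ _)⟩
  have hη'eq : ∀ x ∈ 𝒳, η' x = η x := fun x hx => by
    rw [hη']
    simp only
    rw [min_eq_right (hη01 x hx).2, max_eq_right (hη01 x hx).1]
  have hlaw : jointLaw P η = jointLaw P η' := by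
    refine jointLaw_congr ?_
    filter_upwards [mem_ae_iff.2 hP𝒳] with x hx using (hη'eq x hx).symm
  -- `K` dominates the deviation (first summand), the variation of `η` over a ball of radius `3 ρ`
  -- (`B₁`), and makes `ρ < r₀` (`B₂`); `Ku` gives `Ku * (6 * ρ) ^ D * n = k / 2`
  set B₁ : ℝ := 2 * Cα * (3 * (4 / c) ^ (1 / (D : ℝ))) ^ α with hB₁
  set B₂ : ℝ := ((4 / c) ^ (1 / (D : ℝ)) / r₀) ^ α with hB₂
  have hB₁0 : 0 ≤ B₁ := by positivity
  have hB₂0 : 0 ≤ B₂ := by positivity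
  refine ⟨1, c / (8 * 6 ^ D), 2 * (2 * D + 7) + 3 + B₁ + B₂, one_pos, by positivity,
    by positivity, ?_, ?_⟩
  · intro δ hδ n hn
    rcases le_or_gt 1 δ with hδ1 | hδ1
    · exact ⟨∅, MeasurableSet.empty, by simp [hδ1], by simp⟩
    -- for `n = 1` the margin rate exceeds `1/2` and the interior region is empty
    rcases Nat.lt_or_ge n 2 with hn2 | hn2
    · obtain rfl : n = 1 := by omega
      have hprob := isProbabilityMeasure_jointLaw (P := P) hη'm hη'01
      refine ⟨Set.univ, MeasurableSet.univ, ?_, ?_⟩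
      · rw [hlaw, measure_univ]
        exact ENNReal.ofReal_le_one.2 (by linarith)
      · intro S _ C _ l k hk _ x hx
        exfalso
        have hΔ : marginRate D α (2 * (2 * D + 7) + 3 + B₁ + B₂) δ 1 k ≤ 1 / 2 := by
          refine hx.2.trans (abs_le.2 ?_)
          have := hη01 x hx.1
          exact ⟨by linarith [this.2], by linarith [this.1]⟩
        have hk1 := lt_of_marginRate_le hD hα0 le_rfl (by linarith) hΔ
        obtain rfl : k = 0 := by omega
        have : 0 < Real.log (1 / δ) := Real.log_pos (one_lt_one_div hδ hδ1)
        rw [Nat.cast_zero] at hk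
        exact absurd hk (not_le.2 (by positivity))
    · obtain ⟨E, hE, hPE, hgood⟩ :=
        exists_good_event hD hn2 hη'm hη'01 hm𝒳 hP𝒳 hc hmass hδ hδ1
      refine ⟨E, hE, hlaw ▸ hPE, fun S hS C _ l k hk hkC x hx ŷ hŷ y => ?_⟩
      obtain ⟨hS𝒳, hSdev, hScard⟩ := hgood S hS
      have hk1 : 1 ≤ k := by
        have h1 : 0 < Real.log (1 / δ) := Real.log_pos (one_lt_one_div hδ hδ1)
        have h2 : (0 : ℝ) < k := lt_of_lt_of_le (by positivity) hk
        exact_mod_cast h2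
      have hSdev' : ∀ T : Finset (Fin n), IsBallTrace (fun i => (S i).1) T →
          |∑ i ∈ T, (labelValue (S i).2 - η (S i).1)| ≤
            √(T.card * ((2 * D + 7) * (Real.log n + Real.log (1 / δ))) / 2) := by
        intro T hT
        have h := hSdev T hT
        rwa [Finset.sum_congr rfl fun i _ => by rw [hη'eq _ (hS𝒳 i)]] at h
      rw [kNN_eq_bayesLabel hD hn2 hη01 hα0 hCα hHolder hc hr₀ hδ hδ1 (by linarith)
        (by linarith) (by linarith) hS𝒳 hSdev' hScard hk1 hkC hx hŷ]
      exact eq_comm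
  · intro δ _ k hk
    exact ⟨eventually_lower_bound_le hα0 hD0 hk, 1, marginRate_isBigO hD hα0 _ δ hk⟩
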